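/- Let $N,M\ge 1$, let $|\psi\rangle\in\mathbb C^N\otimes\mathbb C^M=H_A\otimes H_B$ be a unit vector, $\rho_{AB}=|\psi\rangle\langle\psi|$, $\rho_A=\mathrm{Tr}_B\,\rho_{AB}$, $\rho_B=\mathrm{Tr}_A\,\rho_{AB}$, and let $\lambda=(\lambda_1\ge\dots\ge\lambda_N)$ be the spectrum of $\rho_A$ in decreasing order, with $\lambda_k:=0$ for $k>N$. Let $X$ and $Y$ be the von Neumann measurements on $A$ in two orthonormal bases $(|x_i\rangle)$ and $(|y_i\rangle)$ of $H_A$, with outcome probabilities $p_i=\langle x_i|\rho_A|x_i\rangle$ and $q_i=\langle y_i|\rho_A|y_i\rangle$, and post-measurement states $\rho_{XB}=\sum_i(|x_i\rangle\langle x_i|\otimes I)\rho_{AB}(|x_i\rangle\langle x_i|\otimes I)$ and, likewise, $\rho_{YB}$. Write $H(v)=-\sum_i v_i\ln v_i$ (with $0\ln 0=0$). For a state $\sigma$ let $S(\sigma)$ be its von Neumann entropy, i.e. $H$ of its spectrum; put $H(XB)=S(\rho_{XB})$, $H(YB)=S(\rho_{YB})$, $H(B)=S(\rho_B)$, and let $H(X|B)=S(\rho_{XB})-S(\mathrm{Tr}_A\,\rho_{XB})$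 and $H(Y|B)=S(\rho_{YB})-S(\mathrm{Tr}_A\,\rho_{YB})$ be the conditional von Neumann entropies. Let $U_{ij}=\langle x_i|y_j\rangle$, and for $1\le k\le 2N-1$ let $s_k$ be the maximum of the operator norms of the (nonempty) submatrices of $U$ whose number of rows plus number of columns is $k+1$; put $s_0=0$. Let $W=(s_1,s_2-s_1,\dots,s_N-s_{N-1})$. For $0\le k\le 2N$ and $n=\lfloor k/2\rfloor$ let $$S_k=\sum_{i=1}^{n}\lambda_i(1+s_{k-i})+\epsilon_k\,\lambda_{n+1}+\sum_{i=k-n+1}^{k}\lambda_i(1-s_{i-1}),$$ where $\epsilon_k=1$ if $k$ is odd and $\epsilon_k=0$ if $k$ is even, and let $W^{(\lambda)}_k=S_k-S_{k-1}$ for $1\le k\le 2N$. Let $\Lambda$ be the $2N\times N$ matrix with $\Lambda_{kj}=\lambda_k$ if $k\le j$, $\Lambda_{kj}=\lambda_{k-j}$ if $j<k<2j$, and $\Lambda_{kj}=\lambda_{\lceil k/2\rceil}$ if $k\ge 2j$, and let $P=\tfrac12\Lambda\,\mathrm{diag}(W)$. For a joint distribution $P$ let $I(P)$ be its mutual information,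 the sum of the entropies of its two marginals minus the entropy of $P$. Then $$H(X|B)+H(Y|B)=H(XB)+H(YB)-2H(B)=H(p)+H(q)-2H(\lambda)\ \ge\ -\sum_{i=1}^{2N}W^{(\lambda)}_i\ln W^{(\lambda)}_i-2H(\lambda)=2I(P)\ge 0 .$$ Moreover $W^{(\lambda)}=\Lambda W$, and $P$ is a joint probability distribution (nonnegative entries of total sum $1$) whose row sums form the vector $\tfrac12W^{(\lambda)}$ and whose column sums form the vector $W$. -/

import Mathlib

open scoped ComplexOrder Kronecker

noncomputable section

namespace EntropicUncertainty

/-! ### Density matrices, partial traces, local measurements -/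

/-- A density matrix on `ℂ^n`: a positive semidefinite matrix of trace one. -/
structure DensityMatrix (n : Type*) [Fintype n] where
  /-- the underlying complex matrix -/
  mat : Matrix n n ℂ
  posSemidef : mat.PosSemidef
  trace_eq_one : mat.trace = 1

/-- The rank-one operator `|v⟩⟨v|`. -/
def ketbra {n : Type*} (v : EuclideanSpace ℂ n) : Matrix n n ℂ :=
  Matrix.vecMulVec v.ofLp (star v.ofLp)

theorem ketbra_posSemidef {n : Type*} [Fintype n] (v : EuclideanSpace ℂ n) :
    (ketbra v).PosSemidef :=
  Matrix.posSemidef_vecMulVec_self_star _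

theorem ketbra_trace {n : Type*} [Fintype n] (v : EuclideanSpace ℂ n) (hv : ‖v‖ = 1) :
    (ketbra v).trace = 1 := by
  have h : inner ℂ v v = (1 : ℂ) := by
    rw [inner_self_eq_norm_sq_to_K, hv]; simp
  rw [ketbra, Matrix.trace_vecMulVec, ← EuclideanSpace.inner_eq_star_dotProduct, h]

/-- The projectors on the vectors of an orthonormal basis sum to the identity. -/
theorem sum_ketbra {n : Type*} [Fintype n] [DecidableEq n]
    (x : OrthonormalBasis n ℂ (EuclideanSpace ℂ n)) : ∑ i, ketbra (x i) = 1 := by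
  ext a b
  have h := x.sum_inner_mul_inner (EuclideanSpace.single a 1) (EuclideanSpace.single b 1)
  simp only [EuclideanSpace.inner_single_left, EuclideanSpace.inner_single_right] at h
  simpa [Matrix.sum_apply, ketbra, Matrix.vecMulVec_apply, Matrix.one_apply, Pi.single_apply,
    eq_comm] using h

/-- The operator `|v⟩⟨v| ⊗ I_B`. -/
def localProj {a b : Type*} [DecidableEq b] (v : EuclideanSpace ℂ a) :
    Matrix (a × b) (a × b) ℂ :=
  ketbra v ⊗ₖ (1 : Matrix b b ℂ)

theorem localProj_isHermitian {a b : Type*} [Fintype a] [DecidableEq b]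
    (v : EuclideanSpace ℂ a) : (localProj v : Matrix (a × b) (a × b) ℂ).IsHermitian := by
  have h : (ketbra v).conjTranspose = ketbra v := (ketbra_posSemidef v).isHermitian
  rw [localProj, Matrix.IsHermitian, Matrix.conjTranspose_kronecker, h,
    Matrix.conjTranspose_one]

theorem sum_localProj {a b : Type*} [Fintype a] [DecidableEq a] [DecidableEq b]
    (x : OrthonormalBasis a ℂ (EuclideanSpace ℂ a)) :
    ∑ i, (localProj (x i) : Matrix (a × b) (a × b) ℂ) = 1 := by
  rw [← Matrix.one_kronecker_one, ← sum_ketbra x]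
  ext i j
  simp [localProj, Matrix.sum_apply, Matrix.kroneckerMap_apply, Finset.sum_mul]

theorem ketbra_mul_self {n : Type*} [Fintype n] (v : EuclideanSpace ℂ n) (hv : ‖v‖ = 1) :
    ketbra v * ketbra v = ketbra v := by
  have h := ketbra_trace v hv
  rw [ketbra, Matrix.trace_vecMulVec] at h
  rw [ketbra, Matrix.vecMulVec_mul_vecMulVec, dotProduct_comm, h]
  simp

theorem localProj_mul_self {a b : Type*} [Fintype a] [Fintype b] [DecidableEq b]
    (v : EuclideanSpace ℂ a) (hv : ‖v‖ = 1) :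
    (localProj v : Matrix (a × b) (a × b) ℂ) * localProj v = localProj v := by
  rw [localProj, ← Matrix.mul_kronecker_mul, ketbra_mul_self v hv, one_mul]

namespace DensityMatrix

/-- The pure state `|ψ⟩⟨ψ|`. -/
def pure {n : Type*} [Fintype n] (ψ : EuclideanSpace ℂ n) (hψ : ‖ψ‖ = 1) : DensityMatrix n where
  mat := ketbra ψ
  posSemidef := ketbra_posSemidef ψ
  trace_eq_one := ketbra_trace ψ hψ

variable {a b : Type*} [Fintype a] [Fintype b]

/-- The reduced state `ρ_A = Tr_B ρ_AB`. -/
def reduceA (ρ : DensityMatrix (a × b)) : DensityMatrix a where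
  mat := Matrix.of fun i j => ∑ k, ρ.mat (i, k) (j, k)
  posSemidef := by
    have h : (Matrix.of fun i j => ∑ k, ρ.mat (i, k) (j, k)) =
        ∑ k : b, ρ.mat.submatrix (fun i : a => (i, k)) (fun i : a => (i, k)) := by
      ext i j; simp [Matrix.sum_apply]
    rw [h]
    exact Matrix.posSemidef_sum _ fun k _ => ρ.posSemidef.submatrix _
  trace_eq_one := by
    rw [← ρ.trace_eq_one]
    simp [Matrix.trace, Fintype.sum_prod_type]

/-- The reduced state `ρ_B = Tr_A ρ_AB`. -/
def reduceB (ρ : DensityMatrix (a × b)) : DensityMatrix b where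
  mat := Matrix.of fun i j => ∑ k, ρ.mat (k, i) (k, j)
  posSemidef := by
    have h : (Matrix.of fun i j => ∑ k, ρ.mat (k, i) (k, j)) =
        ∑ k : a, ρ.mat.submatrix (fun i : b => (k, i)) (fun i : b => (k, i)) := by
      ext i j; simp [Matrix.sum_apply]
    rw [h]
    exact Matrix.posSemidef_sum _ fun k _ => ρ.posSemidef.submatrix _
  trace_eq_one := by
    rw [← ρ.trace_eq_one]
    simp [Matrix.trace, Fintype.sum_prod_type_right]

/-- The state `ρ_XB = ∑ i, (|x i⟩⟨x i| ⊗ I_B) ρ_AB (|x i⟩⟨x i| ⊗ I_B)` after the von Neumann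
measurement of the subsystem `A` in the orthonormal basis `x`. -/
def measureA [DecidableEq a] [DecidableEq b] (ρ : DensityMatrix (a × b))
    (x : OrthonormalBasis a ℂ (EuclideanSpace ℂ a)) : DensityMatrix (a × b) where
  mat := ∑ i, localProj (x i) * ρ.mat * localProj (x i)
  posSemidef := Matrix.posSemidef_sum _ fun i _ => by
    have h := ρ.posSemidef.mul_mul_conjTranspose_same (localProj (x i))
    rwa [(localProj_isHermitian (x i)).eq] at h
  trace_eq_one := by
    have h : ∀ i, (localProj (x i) * ρ.mat * localProj (x i)).trace =
        (localProj (x i) * ρ.mat).trace := fun i => by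
      rw [Matrix.trace_mul_comm, ← mul_assoc, localProj_mul_self _ (x.norm_eq_one i)]
    rw [Matrix.trace_sum, Finset.sum_congr rfl fun i _ => h i, ← Matrix.trace_sum,
      ← Finset.sum_mul, sum_localProj, one_mul, ρ.trace_eq_one]

/-- The probability vector `i ↦ ⟨x i| ρ |x i⟩` of the measurement in the orthonormal basis `x`. -/
def outcomeProb {N : ℕ} (ρ : DensityMatrix (Fin N))
    (x : OrthonormalBasis (Fin N) ℂ (EuclideanSpace ℂ (Fin N))) (i : Fin N) : ℝ :=
  (star (x i).ofLp ⬝ᵥ ρ.mat.mulVec (x i).ofLp).re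

/-- The spectrum of a density matrix of size `N` (with multiplicities), in decreasing order. -/
def sortedSpectrum {N : ℕ} (ρ : DensityMatrix (Fin N)) (i : Fin N) : ℝ :=
  ρ.posSemidef.isHermitian.eigenvalues₀ (Fin.cast (Fintype.card_fin N).symm i)

end DensityMatrix

/-! ### Entropies -/

/-- `- ∑ i, v i * ln (v i)` with `0 ln 0 = 0`; the Shannon entropy if `v` is a probability
vector. -/
def shannon {ι : Type*} [Fintype ι] (v : ι → ℝ) : ℝ := ∑ i, Real.negMulLog (v i)

/-- The von Neumann entropy: the Shannon entropy of the eigenvalues. -/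
def vonNeumann {n : Type*} [Fintype n] [DecidableEq n] (ρ : DensityMatrix n) : ℝ :=
  shannon ρ.posSemidef.isHermitian.eigenvalues

/-- The conditional von Neumann entropy `H(A|B) = H(AB) - H(B)`. -/
def condEntropy {a b : Type*} [Fintype a] [Fintype b] [DecidableEq a] [DecidableEq b]
    (ρ : DensityMatrix (a × b)) : ℝ :=
  vonNeumann ρ - vonNeumann ρ.reduceB

/-- The first marginal (row sums) of a matrix `P`. -/
def rowMarginal {ι κ : Type*} [Fintype κ] (P : Matrix ι κ ℝ) (i : ι) : ℝ := ∑ j, P i j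

/-- The second marginal (column sums) of a matrix `P`. -/
def colMarginal {ι κ : Type*} [Fintype ι] (P : Matrix ι κ ℝ) (j : κ) : ℝ := ∑ i, P i j

/-- The mutual information of two random variables whose joint distribution is the matrix `P`. -/
def mutualInfo {ι κ : Type*} [Fintype ι] [Fintype κ] (P : Matrix ι κ ℝ) : ℝ :=
  shannon (rowMarginal P) + shannon (colMarginal P) - shannon fun z : ι × κ => P z.1 z.2

/-! ### The majorizing vector -/

/-- The operator norm (largest singular value) of the submatrix of `U` with rows `R` and
columns `C`. -/
def subNorm {N : ℕ} (U : Matrix (Fin N) (Fin N) ℂ) (R C : Finset (Fin N)) : ℝ :=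
  ‖LinearMap.toContinuousLinearMap (Matrix.toEuclideanLin
    (U.submatrix (Subtype.val : R → Fin N) (Subtype.val : C → Fin N)))‖

/-- `s_k`: the largest operator norm of a submatrix of `U` with `#rows + #cols = k + 1`.
For `1 ≤ k ≤ 2 * N - 1` this is the maximum of a nonempty finite set, and `s_0 = 0`. -/
def sCoeff {N : ℕ} (U : Matrix (Fin N) (Fin N) ℂ) (k : ℕ) : ℝ :=
  sSup {t | ∃ R C : Finset (Fin N), R.Nonempty ∧ C.Nonempty ∧ R.card + C.card = k + 1 ∧
    t = subNorm U R C}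

/-- The vector `W = (s_1, s_2 - s_1, …, s_N - s_{N-1})`. -/
def wVec {N : ℕ} (U : Matrix (Fin N) (Fin N) ℂ) (j : Fin N) : ℝ :=
  sCoeff U (j + 1) - sCoeff U j

/-- A vector of length `N`, indexed from `1` and continued by `0`. -/
def pad {N : ℕ} (v : Fin N → ℝ) (k : ℕ) : ℝ :=
  if h : 1 ≤ k ∧ k ≤ N then v ⟨k - 1, by omega⟩ else 0

/-- The sums `S_k`, where `n = ⌊k/2⌋`:
`λ_1 (1 + s_{k-1}) + … + λ_n (1 + s_{k-n})`, plus, if `k` is odd, `λ_{n+1}`, plus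
`λ_{k-n+1} (1 - s_{k-n}) + … + λ_k (1 - s_{k-1})`. -/
def bigS {N : ℕ} (lam : Fin N → ℝ) (U : Matrix (Fin N) (Fin N) ℂ) (k : ℕ) : ℝ :=
  if k % 2 = 0 then
    ∑ i ∈ Finset.Icc 1 (k / 2), pad lam i * (1 + sCoeff U (k - i)) +
      ∑ i ∈ Finset.Icc (k / 2 + 1) k, pad lam i * (1 - sCoeff U (i - 1))
  else
    ∑ i ∈ Finset.Icc 1 (k / 2), pad lam i * (1 + sCoeff U (k - i)) + pad lam (k / 2 + 1) +
      ∑ i ∈ Finset.Icc (k / 2 + 2) k, pad lam i * (1 - sCoeff U (i - 1))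

/-- The vector `W^{(λ)}` of length `2 * N`, with entries `S_k - S_{k-1}` for `k = 1, …, 2 * N`
(where `S_0 = 0` is an empty sum). -/
def wLam {N : ℕ} (lam : Fin N → ℝ) (U : Matrix (Fin N) (Fin N) ℂ) (k : Fin (2 * N)) : ℝ :=
  bigS lam U (k + 1) - bigS lam U k

/-- The `2N × N` matrix `Λ`. Counting rows and columns from `1`, its entry in row `k` and column
`j` is `λ_k` for `k ≤ j`, `λ_{k-j}` for `j < k < 2 j`, and `λ_{⌈k/2⌉}` for `2 j ≤ k`. -/
def lamMatrix {N : ℕ} (lam : Fin N → ℝ) : Matrix (Fin (2 * N)) (Fin N) ℝ :=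
  Matrix.of fun k j =>
    if (k : ℕ) + 1 ≤ (j : ℕ) + 1 then pad lam (k + 1)
    else if (k : ℕ) + 1 < 2 * ((j : ℕ) + 1) then pad lam ((k + 1) - (j + 1))
    else pad lam (((k + 1) + 1) / 2)

/-- The matrix `P = ½ Λ diag(W)`. -/
def jointP {N : ℕ} (lam : Fin N → ℝ) (U : Matrix (Fin N) (Fin N) ℂ) :
    Matrix (Fin (2 * N)) (Fin N) ℝ :=
  (1 / 2 : ℝ) • (lamMatrix lam * Matrix.diagonal (wVec U))

end EntropicUncertainty

end

namespace EntropicUncertainty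

/-! ### Summation by parts and Schur concavity of the entropy -/

/-! The heart of the proof is that the vector `p ⊕ q` of length `2N` is majorized by `W^{(λ)}`; the
inequality is then Schur concavity of the entropy (`shannon_le_of_majorized`).

A set `I` of `k` vectors from the two bases has total probability `∑ λ_l ⟨e_l|T|e_l⟩`, where the
`e_l` form an eigenbasis of `ρ_A` and `T` is the sum of the projections on these vectors. As `λ`
decreases, summation by parts reduces the bound by `S_k` to a bound of Ky Fan type on `⟨e_l|T|e_l⟩`
summed over `l ≤ m`, for each `m` (`sum_sum_norm_sq_inner_le`). The nonzero spectrum of `T` is that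
of the Gram matrix of the `k` vectors, whose eigenvalues are `1 ± σ` for the singular values `σ` of
a submatrix of `U`, together with ones. Deleting `i` rows or columns shows that the singular value
number `i + 1` is at most `s_{k-1-i}` (`sum_norm_sq_synthesis_le`); the symmetry `σ ↦ -σ` and the
trace `k` handle large `m`.

The identity `W^{(λ)} = Λ W` is a count of how often each `λ_i` occurs in the first `k` rows of a
column of `Λ`. Each column of `Λ` consists of two copies of `λ`, so the entropy of `P` is `ln 2 +
H(λ) + H(W)`, which gives the mutual information.

On the quantum side, with `Ψ` the coefficient matrix of `ψ`, all entropies follow from the equality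
of the nonzero spectra of `AB` and `BA`: `ρ_A = ΨΨ*`, `ρ_B = (Ψ*Ψ)ᵀ`, and `ρ_XB = VV*` with `V*V =
diag(p)`. -/

/-- Summation by parts, for a monotone weight and nonnegative partial sums. -/
theorem sum_mul_le_of_monotone {g d : ℕ → ℝ} {n : ℕ}
    (hg : ∀ i, i + 1 < n → g i ≤ g (i + 1))
    (hd : ∀ m ≤ n, 0 ≤ ∑ i ∈ Finset.range m, d i) :
    ∑ i ∈ Finset.range n, g i * d i ≤ g (n - 1) * ∑ i ∈ Finset.range n, d i := by
  induction n with
  | zero => simp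
  | succ n ih =>
    have h := ih (fun i hi => hg i (by omega)) (fun m hm => hd m (by omega))
    rw [Finset.sum_range_succ, Finset.sum_range_succ, mul_add, Nat.add_sub_cancel]
    rcases Nat.eq_zero_or_pos n with rfl | hn
    · simp
    · have h1 : g (n - 1) ≤ g n := by
        have := hg (n - 1) (by omega)
        rwa [Nat.sub_add_cancel hn] at this
      nlinarith [mul_le_mul_of_nonneg_right h1 (hd n (by omega))]

/-- Sums against an antitone nonnegative weight are monotone in the partial sums. -/
theorem sum_mul_le_sum_mul_of_antitone {c t u : ℕ → ℝ} {n : ℕ}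
    (hc : ∀ i, i + 1 < n → c (i + 1) ≤ c i) (hc0 : ∀ i, 0 ≤ c i)
    (h : ∀ m ≤ n, ∑ i ∈ Finset.range m, t i ≤ ∑ i ∈ Finset.range m, u i) :
    ∑ i ∈ Finset.range n, c i * t i ≤ ∑ i ∈ Finset.range n, c i * u i := by
  have hd : ∀ m ≤ n, 0 ≤ ∑ i ∈ Finset.range m, (u i - t i) := fun m hm => by
    rw [Finset.sum_sub_distrib]; linarith [h m hm]
  have h1 := sum_mul_le_of_monotone (g := fun i => -c i) (d := fun i => u i - t i) (n := n)
    (fun i hi => neg_le_neg (hc i hi)) hd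
  have h2 : ∑ i ∈ Finset.range n, -c i * (u i - t i) =
      ∑ i ∈ Finset.range n, c i * t i - ∑ i ∈ Finset.range n, c i * u i := by
    rw [← Finset.sum_sub_distrib]; exact Finset.sum_congr rfl fun i _ => by ring
  rw [h2] at h1
  nlinarith [mul_nonneg (hc0 (n - 1)) (hd n le_rfl)]

theorem negMulLog_le_tangent {a w : ℝ} (ha : 0 < a) (hw : 0 ≤ w) :
    Real.negMulLog w ≤ Real.negMulLog a + (-Real.log a - 1) * (w - a) := by
  rcases hw.eq_or_lt with rfl | hw
  · simp only [Real.negMulLog]; simp; nlinarith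
  · have h := Real.log_le_sub_one_of_pos (div_pos ha hw)
    rw [Real.log_div ha.ne' hw.ne'] at h
    have h2 := mul_le_mul_of_nonneg_left h hw.le
    have h3 : w * (a / w - 1) = a - w := by field_simp
    simp only [Real.negMulLog]
    nlinarith

/-- The entropy of a decreasing sequence dominates that of any sequence with larger partial
sums and the same total sum. -/
theorem sum_negMulLog_le_of_partialSums {a w : ℕ → ℝ} {n : ℕ}
    (ha : ∀ i j, i ≤ j → j < n → a j ≤ a i) (ha0 : ∀ i, 0 ≤ a i) (hw0 : ∀ i, 0 ≤ w i)
    (h : ∀ m ≤ n, ∑ i ∈ Finset.range m, a i ≤ ∑ i ∈ Finset.range m, w i)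
    (heq : ∑ i ∈ Finset.range n, a i = ∑ i ∈ Finset.range n, w i) :
    ∑ i ∈ Finset.range n, Real.negMulLog (w i) ≤ ∑ i ∈ Finset.range n, Real.negMulLog (a i) := by
  -- Once `a` vanishes its partial sum has reached the total, hence so has that of `w`. The
  -- logarithm at `a m = 0` is thereby avoided.
  have hzero : ∀ m < n, a m = 0 → w m = 0 := fun m hm h0 => by
    have h1 : ∑ i ∈ Finset.range n, a i = ∑ i ∈ Finset.range m, a i := by
      symm
      refine Finset.sum_subset (by simpa using hm.le) fun i hi hi' => ?_
      simp only [Finset.mem_range, not_lt] at hi hi'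
      exact le_antisymm (h0 ▸ ha m i hi' hi) (ha0 i)
    have h2 : ∑ i ∈ Finset.range (m + 1), w i ≤ ∑ i ∈ Finset.range n, w i :=
      Finset.sum_le_sum_of_subset_of_nonneg (by simpa using hm) fun i _ _ => hw0 i
    rw [Finset.sum_range_succ] at h2
    exact le_antisymm (by linarith [h m hm.le]) (hw0 m)
  -- `g` is the slope of the tangent at `a i`. Where `a i = 0` any value serves that keeps `g`
  -- monotone, and `C` exceeds all the other slopes.
  set C : ℝ := ∑ i ∈ Finset.range n, |Real.log (a i)|
  set g : ℕ → ℝ := fun i => if 0 < a i then -Real.log (a i) - 1 else C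
  have hg : ∀ i, i + 1 < n → g i ≤ g (i + 1) := fun i hi => by
    have h1 := ha i (i + 1) (by omega) hi
    simp only [g]
    by_cases h2 : 0 < a (i + 1)
    · rw [if_pos h2, if_pos (h2.trans_le h1)]
      linarith [Real.log_le_log h2 h1]
    · rw [if_neg h2]
      split_ifs with h3
      · have h4 : |Real.log (a i)| ≤ C :=
          Finset.single_le_sum (f := fun i => |Real.log (a i)|) (fun _ _ => abs_nonneg _)
            (Finset.mem_range.2 (by omega))
        linarith [neg_abs_le (Real.log (a i))]
      · exact le_rfl
  have hd : ∀ m ≤ n, 0 ≤ ∑ i ∈ Finset.range m, (w i - a i) := fun m hm => by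
    rw [Finset.sum_sub_distrib]; linarith [h m hm]
  have h1 := sum_mul_le_of_monotone hg hd
  rw [Finset.sum_sub_distrib w a, heq, sub_self, mul_zero] at h1
  have h2 : ∀ i ∈ Finset.range n,
      Real.negMulLog (w i) ≤ Real.negMulLog (a i) + g i * (w i - a i) := fun i hi => by
    rcases (ha0 i).eq_or_lt with h0 | h0
    · rw [hzero i (Finset.mem_range.1 hi) h0.symm, ← h0]; simp
    · simp only [g, if_pos h0]
      exact negMulLog_le_tangent h0 (hw0 i)
  have h3 := Finset.sum_le_sum h2
  rw [Finset.sum_add_distrib] at h3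
  linarith

/-- Schur concavity of the Shannon entropy. -/
theorem shannon_le_of_majorized {ι : Type*} [Fintype ι] {n : ℕ}
    (hn : Fintype.card ι = n) {a : ι → ℝ} {w : ℕ → ℝ} (ha0 : ∀ i, 0 ≤ a i) (hw0 : ∀ i, 0 ≤ w i)
    (h : ∀ I : Finset ι, ∑ i ∈ I, a i ≤ ∑ i ∈ Finset.range I.card, w i)
    (heq : ∑ i, a i = ∑ i ∈ Finset.range n, w i) :
    ∑ i ∈ Finset.range n, Real.negMulLog (w i) ≤ shannon a := by
  classical
  -- Only `a` is sorted: the partial sums of `w` in the given order already dominate those of the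
  -- sorted `a`.
  let e : Fin n ≃ ι := (Fintype.equivFinOfCardEq hn).symm
  let σ : Fin n ≃ ι := (Tuple.sort fun i => -a (e i)).trans e
  have hσ : Antitone fun i => a (σ i) := fun i j hij => by
    have := Tuple.monotone_sort (fun i => -a (e i)) hij
    simpa [σ] using this
  let b : ℕ → ℝ := fun i => if hi : i < n then a (σ ⟨i, hi⟩) else 0
  have hsum : ∀ f : ℝ → ℝ, ∑ i ∈ Finset.range n, f (b i) = ∑ i, f (a i) := fun f => by
    rw [Finset.sum_range, ← σ.sum_comp]
    exact Finset.sum_congr rfl fun i _ => by simp [b]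
  have hb : ∑ i ∈ Finset.range n, b i = ∑ i, a i := hsum id
  have hpart : ∀ m ≤ n, ∑ i ∈ Finset.range m, b i ≤ ∑ i ∈ Finset.range m, w i := fun m hm => by
    have h1 := h ((Finset.univ : Finset (Fin m)).map
      ((Fin.castLEEmb hm).trans σ.toEmbedding))
    rw [Finset.sum_map, Finset.card_map, Finset.card_univ, Fintype.card_fin] at h1
    refine le_of_eq_of_le ?_ h1
    rw [Finset.sum_range]
    refine Finset.sum_congr rfl fun i _ => ?_
    simp [b, i.2.trans_le hm]
    rfl
  rw [shannon, ← hsum Real.negMulLog]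
  refine sum_negMulLog_le_of_partialSums (fun i j hij hj => ?_) (fun i => ?_) hw0 hpart
    (hb.trans heq)
  · simp only [b, dif_pos hj, dif_pos (hij.trans_lt hj)]
    exact hσ (by simpa using hij)
  · simp only [b]; split_ifs
    · exact ha0 _
    · exact le_rfl

/-! ### Mutual information -/

theorem mutualInfo_nonneg {ι κ : Type*} [Fintype ι] [Fintype κ] {P : Matrix ι κ ℝ}
    (hP : ∀ i j, 0 ≤ P i j) (h1 : ∑ i, ∑ j, P i j = 1) : 0 ≤ mutualInfo P := by
  have hr : ∀ i j, P i j ≤ rowMarginal P i := fun i j =>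
    Finset.single_le_sum (f := fun j => P i j) (fun j _ => hP i j) (Finset.mem_univ j)
  have hc : ∀ i j, P i j ≤ colMarginal P j := fun i j =>
    Finset.single_le_sum (f := fun i => P i j) (fun i _ => hP i j) (Finset.mem_univ i)
  -- Gibbs' inequality termwise: the tangent of `negMulLog` at the product of the marginals. Both
  -- sides of the summed inequality then involve only total masses and entropies.
  have key : ∀ i j, P i j - rowMarginal P i * colMarginal P j ≤
      P i j * Real.log (P i j) - P i j * Real.log (rowMarginal P i)
        - P i j * Real.log (colMarginal P j) := fun i j => by
    rcases (hP i j).eq_or_lt with h | h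
    · rw [← h]
      have := mul_nonneg ((hP i j).trans (hr i j)) ((hP i j).trans (hc i j))
      simp; linarith
    · have hr' := h.trans_le (hr i j)
      have hc' := h.trans_le (hc i j)
      have h2 := negMulLog_le_tangent (mul_pos hr' hc') h.le
      simp only [Real.negMulLog, Real.log_mul hr'.ne' hc'.ne'] at h2
      nlinarith
  have hsum := Finset.sum_le_sum fun i (_ : i ∈ Finset.univ) =>
    Finset.sum_le_sum fun j (_ : j ∈ Finset.univ) => key i j
  have hrow : ∑ i, rowMarginal P i = 1 := h1
  have hcol : ∑ j, colMarginal P j = 1 :=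
    (Finset.sum_comm (f := fun j i => P i j)).trans h1
  have e1 : ∑ i, ∑ j, P i j * Real.log (rowMarginal P i) = - shannon (rowMarginal P) := by
    rw [shannon, ← Finset.sum_neg_distrib]
    refine Finset.sum_congr rfl fun i _ => ?_
    rw [← Finset.sum_mul, Real.negMulLog, neg_mul, neg_neg]; rfl
  have e2 : ∑ i, ∑ j, P i j * Real.log (colMarginal P j) = - shannon (colMarginal P) := by
    rw [shannon, ← Finset.sum_neg_distrib, Finset.sum_comm]
    refine Finset.sum_congr rfl fun i _ => ?_
    rw [← Finset.sum_mul, Real.negMulLog, neg_mul, neg_neg]; rfl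
  have e3 : ∑ i, ∑ j, P i j * Real.log (P i j) = - shannon fun z : ι × κ => P z.1 z.2 := by
    rw [shannon, Fintype.sum_prod_type, ← Finset.sum_neg_distrib]
    refine Finset.sum_congr rfl fun i _ => ?_
    rw [← Finset.sum_neg_distrib]
    refine Finset.sum_congr rfl fun j _ => ?_
    rw [Real.negMulLog, neg_mul, neg_neg]
  have e4 : ∑ i, ∑ j, rowMarginal P i * colMarginal P j = 1 := by
    rw [← Finset.sum_mul_sum, hrow, hcol, one_mul]
  simp only [Finset.sum_sub_distrib] at hsum
  rw [e1, e2, e3, e4, h1] at hsum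
  rw [mutualInfo]
  linarith

/-! ### The vectors `W` and `W^{(λ)}` -/

/-- The number of those of the indices `i` that occur in the first `k` rows of column `j` of the
matrix `Λ` (all counted from `0`). -/
def multiplicity (k i j : ℕ) : ℝ :=
  (if i < max (min k (j + 1)) ((k + 1) / 2) then 1 else 0) +
    (if i < min (k / 2) (k - (j + 1)) then 1 else 0)

/-- The index of the entry of `λ` in row `k` and column `j` of the matrix `Λ` (all counted
from `0`). -/
def lamIndex (k j : ℕ) : ℕ :=
  if k ≤ j then k else if k + 1 < 2 * (j + 1) then k - j - 1 else k / 2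

/-- Column `j` reads a first copy of `λ` in rows `0, …, j` and starts a second copy in row `j + 1`.
After row `2j + 1` the second copy has caught up, and from then on the two alternate. The two
summands of `multiplicity` record whether each copy has passed `i`. -/
theorem multiplicity_succ_sub (k i j : ℕ) :
    multiplicity (k + 1) i j - multiplicity k i j = if i = lamIndex k j then 1 else 0 := by
  unfold multiplicity lamIndex
  split_ifs <;> first | (exfalso; omega) | norm_num

theorem lamMatrix_apply {N : ℕ} (lam : Fin N → ℝ) (k : Fin (2 * N)) (j : Fin N) :
    lamMatrix lam k j = pad lam (lamIndex k j + 1) := by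
  simp only [lamMatrix, Matrix.of_apply, lamIndex]
  split_ifs <;> first | (exfalso; omega) | rfl | (congr 1; omega)

theorem sum_mul_multiplicity_succ_sub {N : ℕ} (g : ℕ → ℝ) {k : ℕ} (hk : k < 2 * N) (j : ℕ) :
    ∑ i ∈ Finset.range (2 * N), g i * multiplicity (k + 1) i j -
      ∑ i ∈ Finset.range (2 * N), g i * multiplicity k i j = g (lamIndex k j) := by
  have h : lamIndex k j < 2 * N := by unfold lamIndex; split_ifs <;> omega
  simp_rw [← Finset.sum_sub_distrib, ← mul_sub, multiplicity_succ_sub, mul_ite, mul_one, mul_zero]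
  rw [Finset.sum_ite_eq', if_pos (Finset.mem_range.2 h)]

/-- Every column of `Λ` is a rearrangement of two copies of `λ`. -/
theorem sum_lamIndex {N : ℕ} (g : ℕ → ℝ) {j : ℕ} (hj : j < N) :
    ∑ k ∈ Finset.range (2 * N), g (lamIndex k j) = 2 * ∑ i ∈ Finset.range N, g i := by
  rw [Finset.sum_congr rfl fun k hk =>
      (sum_mul_multiplicity_succ_sub g (Finset.mem_range.1 hk) j).symm,
    Finset.sum_range_sub fun k => ∑ i ∈ Finset.range (2 * N), g i * multiplicity k i j]
  have h2 : ∀ i, multiplicity 0 i j = 0 := fun i => by simp [multiplicity]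
  have h3 : ∀ i, multiplicity (2 * N) i j = if i < N then 2 else 0 := fun i => by
    unfold multiplicity; split_ifs <;> first | (exfalso; omega) | norm_num
  simp only [h2, h3, mul_zero, Finset.sum_const_zero, sub_zero, mul_ite]
  rw [← Finset.sum_filter, Finset.mul_sum]
  refine Finset.sum_congr ?_ fun i _ => mul_comm _ _
  ext i; simp; omega

/-! ### The coefficients of `λ` in `S_k` and the identity `W^{(λ)} = Λ W` -/

/-- The coefficient of the `i`-th entry of `λ` (counted from `0`) in `S_k`. -/
def sWeight (s : ℕ → ℝ) (k i : ℕ) : ℝ :=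
  if 2 * (i + 1) ≤ k then 1 + s (k - 1 - i) else if 2 * i + 1 = k then 1
  else if i < k then 1 - s i else 0

theorem sum_Icc_eq_sum_range (f : ℕ → ℝ) {a b K : ℕ} (ha : 1 ≤ a) (hb : b ≤ K) :
    ∑ i ∈ Finset.Icc a b, f i =
      ∑ i ∈ Finset.range K, if a ≤ i + 1 ∧ i + 1 ≤ b then f (i + 1) else 0 := by
  rw [← Finset.sum_filter]
  refine Finset.sum_nbij' (fun i => i - 1) (fun i => i + 1) ?_ ?_ ?_ ?_ ?_
  · intro i hi; simp at hi ⊢; omega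
  · intro i hi; simp at hi ⊢; omega
  · intro i hi; simp at hi ⊢; omega
  · intro i hi; simp
  · intro i hi; simp at hi ⊢; rw [Nat.sub_add_cancel (by omega)]

theorem bigS_eq_sum_sWeight {N : ℕ} (lam : Fin N → ℝ) (U : Matrix (Fin N) (Fin N) ℂ) {k K : ℕ}
    (hK : k ≤ K) :
    bigS lam U k = ∑ i ∈ Finset.range K, pad lam (i + 1) * sWeight (sCoeff U) k i := by
  unfold bigS
  split_ifs with h
  · rw [sum_Icc_eq_sum_range _ le_rfl (by omega : k / 2 ≤ K),
      sum_Icc_eq_sum_range _ (by omega) hK, ← Finset.sum_add_distrib]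
    refine Finset.sum_congr rfl fun i _ => ?_
    unfold sWeight
    have e : k - (i + 1) = k - 1 - i := by omega
    rw [Nat.add_sub_cancel, e]
    split_ifs <;> first | (exfalso; omega) | ring
  · rw [sum_Icc_eq_sum_range _ le_rfl (by omega : k / 2 ≤ K),
      sum_Icc_eq_sum_range _ (by omega) hK]
    have hm : pad lam (k / 2 + 1) =
        ∑ i ∈ Finset.range K, if i = k / 2 then pad lam (i + 1) else 0 := by
      rw [Finset.sum_ite_eq', if_pos (Finset.mem_range.2 (by omega))]
    rw [hm, ← Finset.sum_add_distrib, ← Finset.sum_add_distrib]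
    refine Finset.sum_congr rfl fun i _ => ?_
    unfold sWeight
    have e : k - (i + 1) = k - 1 - i := by omega
    rw [Nat.add_sub_cancel, e]
    split_ifs <;> first | (exfalso; omega) | ring

/-- The bound for the sum of the `m` largest eigenvalues of a sum of two projections of total
rank `k`. -/
def kyFanBound (s : ℕ → ℝ) (k m : ℕ) : ℝ :=
  (min m k : ℕ) + ∑ i ∈ Finset.range (min m (k - m)), s (k - 1 - i)

/-- In the step from `m` to `m + 1` the bound gains `1 + s_{k-1-m}` while `2(m + 1) ≤ k`, then `1`
at the middle index of an odd `k`. After that it gains `1` and loses the summand `s_m`; beyond `k`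
it is constant, since `k - m` truncates to `0`. -/
theorem sum_sWeight (s : ℕ → ℝ) (k m : ℕ) :
    ∑ i ∈ Finset.range m, sWeight s k i = kyFanBound s k m := by
  induction m with
  | zero => simp [kyFanBound]
  | succ m ih =>
    rw [Finset.sum_range_succ, ih]
    unfold kyFanBound sWeight
    split_ifs with h1 h2 h3
    · rw [show min (m + 1) (k - (m + 1)) = m + 1 by omega, show min m (k - m) = m by omega,
        show min (m + 1) k = m + 1 by omega, show min m k = m by omega, Finset.sum_range_succ]
      push_cast; ring
    · rw [show min (m + 1) (k - (m + 1)) = m by omega, show min m (k - m) = m by omega,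
        show min (m + 1) k = m + 1 by omega, show min m k = m by omega]
      push_cast; ring
    · rw [show min (m + 1) (k - (m + 1)) = k - (m + 1) by omega,
        show min m (k - m) = k - (m + 1) + 1 by omega,
        show min (m + 1) k = m + 1 by omega, show min m k = m by omega, Finset.sum_range_succ,
        show k - 1 - (k - (m + 1)) = m by omega]
      push_cast; ring
    · rw [show min (m + 1) (k - (m + 1)) = 0 by omega, show min m (k - m) = 0 by omega,
        show min (m + 1) k = k by omega, show min m k = k by omega]
      ring

theorem sWeight_nonneg {s : ℕ → ℝ} (h0 : ∀ i, 0 ≤ s i) (h1 : ∀ i, s i ≤ 1) (k i : ℕ) :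
    0 ≤ sWeight s k i := by
  unfold sWeight
  split_ifs <;> linarith [h0 (k - 1 - i), h1 i]

theorem kyFanBound_mono {s : ℕ → ℝ} (h0 : ∀ i, 0 ≤ s i) (h1 : ∀ i, s i ≤ 1) (k : ℕ) :
    Monotone (kyFanBound s k) := fun m n hmn => by
  rw [← sum_sWeight, ← sum_sWeight]
  exact Finset.sum_le_sum_of_subset_of_nonneg (by simpa using hmn)
    fun i _ _ => sWeight_nonneg h0 h1 k i

/-- The sum telescopes to `s_{min(k,N)}`, and `s` is constantly `1` from `N` to `2N - 1`. At `k =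
2N` no submatrix exists and the supremum defaults to `0`, whence the strict bound on `k`. -/
theorem sum_wVec {N : ℕ} {U : Matrix (Fin N) (Fin N) ℂ} (h0 : sCoeff U 0 = 0)
    (hN : ∀ k, N ≤ k → k < 2 * N → sCoeff U k = 1) {k : ℕ} (hk : k < 2 * N) :
    sCoeff U k = ∑ j : Fin N, wVec U j * if (j : ℕ) + 1 ≤ k then 1 else 0 := by
  have h1 : ∀ m, ∑ j ∈ Finset.range m, (sCoeff U (j + 1) - sCoeff U j) = sCoeff U m := fun m => by
    rw [Finset.sum_range_sub, h0, sub_zero]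
  have h2 : ∑ j : Fin N, wVec U j * (if (j : ℕ) + 1 ≤ k then 1 else 0) =
      sCoeff U (min k N) := by
    unfold wVec
    rw [← h1, ← Finset.sum_range
      fun j : ℕ => (sCoeff U (j + 1) - sCoeff U j) * if j + 1 ≤ k then 1 else 0]
    simp only [mul_ite, mul_one, mul_zero]
    rw [← Finset.sum_filter]
    refine Finset.sum_congr ?_ fun _ _ => rfl
    ext i; simp; omega
  rw [h2]
  rcases le_total k N with h | h
  · rw [min_eq_left h]
  · rw [min_eq_right h, hN k h hk, hN N le_rfl (by omega)]

theorem sum_wVec_eq_one {N : ℕ} {U : Matrix (Fin N) (Fin N) ℂ} (h0 : sCoeff U 0 = 0)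
    (hN : ∀ k, N ≤ k → k < 2 * N → sCoeff U k = 1) (hpos : 0 < N) :
    ∑ j, wVec U j = 1 := by
  rw [← hN N le_rfl (by omega), sum_wVec h0 hN (by omega : N < 2 * N)]
  refine Finset.sum_congr rfl fun j _ => ?_
  rw [if_pos (by omega), mul_one]

/-- For `2(i + 1) ≤ k` the first copy of `λ_i` has been read in every column and the second exactly
when `j + 1 ≤ k - 1 - i`; weighting with `W` gives `1 + s_{k-1-i}`. For larger `i < k`, apart from
the middle index, only the first copy can have been read, namely when `j ≥ i`, which gives `1 -
s_i`. -/
theorem sWeight_eq_sum {N : ℕ} {U : Matrix (Fin N) (Fin N) ℂ} (h0 : sCoeff U 0 = 0)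
    (hN : ∀ k, N ≤ k → k < 2 * N → sCoeff U k = 1) (hpos : 0 < N) {k : ℕ} (hk : k ≤ 2 * N)
    (i : ℕ) :
    sWeight (sCoeff U) k i = ∑ j : Fin N, wVec U j * multiplicity k i j := by
  have h1 := sum_wVec_eq_one h0 hN hpos
  unfold sWeight
  split_ifs with ha hb hc
  · rw [← h1, sum_wVec h0 hN (by omega : k - 1 - i < 2 * N), ← Finset.sum_add_distrib]
    refine Finset.sum_congr rfl fun j _ => ?_
    unfold multiplicity
    split_ifs <;> first | (exfalso; omega) | ring
  · rw [← h1]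
    refine Finset.sum_congr rfl fun j _ => ?_
    unfold multiplicity
    split_ifs <;> first | (exfalso; omega) | ring
  · rw [← h1, sum_wVec h0 hN (by omega : i < 2 * N), ← Finset.sum_sub_distrib]
    refine Finset.sum_congr rfl fun j _ => ?_
    unfold multiplicity
    split_ifs <;> first | (exfalso; omega) | ring
  · symm
    refine Finset.sum_eq_zero fun j _ => ?_
    unfold multiplicity
    split_ifs <;> first | (exfalso; omega) | ring

theorem bigS_eq_sum_wVec {N : ℕ} (lam : Fin N → ℝ) {U : Matrix (Fin N) (Fin N) ℂ}
    (h0 : sCoeff U 0 = 0) (hN : ∀ k, N ≤ k → k < 2 * N → sCoeff U k = 1) (hpos : 0 < N) {k : ℕ}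
    (hk : k ≤ 2 * N) :
    bigS lam U k = ∑ j : Fin N,
      wVec U j * ∑ i ∈ Finset.range (2 * N), pad lam (i + 1) * multiplicity k i j := by
  rw [bigS_eq_sum_sWeight lam U hk]
  simp_rw [sWeight_eq_sum h0 hN hpos hk, Finset.mul_sum]
  rw [Finset.sum_comm]
  exact Finset.sum_congr rfl fun j _ => Finset.sum_congr rfl fun i _ => by ring

theorem wLam_eq_mulVec {N : ℕ} (lam : Fin N → ℝ) {U : Matrix (Fin N) (Fin N) ℂ}
    (h0 : sCoeff U 0 = 0) (hN : ∀ k, N ≤ k → k < 2 * N → sCoeff U k = 1) (hpos : 0 < N) :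
    wLam lam U = (lamMatrix lam).mulVec (wVec U) := by
  ext k
  rw [wLam, bigS_eq_sum_wVec lam h0 hN hpos (by omega), bigS_eq_sum_wVec lam h0 hN hpos (by omega),
    ← Finset.sum_sub_distrib, Matrix.mulVec, dotProduct]
  refine Finset.sum_congr rfl fun j _ => ?_
  rw [← mul_sub, sum_mul_multiplicity_succ_sub (fun i => pad lam (i + 1)) k.2, lamMatrix_apply,
    mul_comm]

theorem sum_pad {N : ℕ} (f : ℝ → ℝ) (lam : Fin N → ℝ) :
    ∑ i ∈ Finset.range N, f (pad lam (i + 1)) = ∑ i, f (lam i) := by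
  rw [Finset.sum_range]
  refine Finset.sum_congr rfl fun i _ => ?_
  rw [pad, dif_pos (by omega)]; rfl

theorem sum_lamMatrix {N : ℕ} (f : ℝ → ℝ) (lam : Fin N → ℝ) (j : Fin N) :
    ∑ k, f (lamMatrix lam k j) = 2 * ∑ i, f (lam i) := by
  simp_rw [lamMatrix_apply]
  rw [← Finset.sum_range fun k => f (pad lam (lamIndex k j + 1)),
    sum_lamIndex (fun i => f (pad lam (i + 1))) j.2, sum_pad]

/-! ### Marginals and entropy of the joint distribution `P` -/

theorem jointP_apply {N : ℕ} (lam : Fin N → ℝ) (U : Matrix (Fin N) (Fin N) ℂ) (k : Fin (2 * N))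
    (j : Fin N) : jointP lam U k j = 1 / 2 * lamMatrix lam k j * wVec U j := by
  simp [jointP, Matrix.mul_diagonal, mul_assoc]

theorem colMarginal_jointP {N : ℕ} {lam : Fin N → ℝ} (hlam : ∑ i, lam i = 1)
    (U : Matrix (Fin N) (Fin N) ℂ) (j : Fin N) : colMarginal (jointP lam U) j = wVec U j := by
  have h := sum_lamMatrix id lam j
  simp only [id, hlam] at h
  simp only [colMarginal, jointP_apply]
  rw [← Finset.sum_mul, ← Finset.mul_sum, h]; ring

theorem rowMarginal_jointP {N : ℕ} {lam : Fin N → ℝ} {U : Matrix (Fin N) (Fin N) ℂ}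
    (h : wLam lam U = (lamMatrix lam).mulVec (wVec U)) (k : Fin (2 * N)) :
    rowMarginal (jointP lam U) k = 1 / 2 * wLam lam U k := by
  simp only [rowMarginal, jointP_apply, h, Matrix.mulVec, dotProduct, Finset.mul_sum, mul_assoc]

theorem pad_nonneg {N : ℕ} {lam : Fin N → ℝ} (h : ∀ i, 0 ≤ lam i) (k : ℕ) : 0 ≤ pad lam k := by
  unfold pad; split_ifs
  · exact h _
  · exact le_rfl

theorem shannon_half {ι : Type*} [Fintype ι] {v : ι → ℝ} (hv : ∑ i, v i = 2) :
    shannon (fun i => 1 / 2 * v i) = 1 / 2 * shannon v + Real.log 2 := by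
  have h : Real.negMulLog (1 / 2) = 1 / 2 * Real.log 2 := by
    simp [Real.negMulLog, Real.log_inv]
  simp only [shannon, Real.negMulLog_mul, Finset.sum_add_distrib, ← Finset.sum_mul,
    ← Finset.mul_sum, hv, h]
  ring

/-- The mutual information of `P = ½ Λ diag(W)`. -/
theorem two_mul_mutualInfo_jointP {N : ℕ} {lam : Fin N → ℝ} (hlam : ∑ i, lam i = 1)
    {U : Matrix (Fin N) (Fin N) ℂ} (h : wLam lam U = (lamMatrix lam).mulVec (wVec U))
    (hW : ∑ j, wVec U j = 1) :
    2 * mutualInfo (jointP lam U) = shannon (wLam lam U) - 2 * shannon lam := by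
  have hL : ∀ j, ∑ k, lamMatrix lam k j = 2 := fun j => by
    have h := sum_lamMatrix id lam j
    simpa only [id, hlam, mul_one] using h
  have hw2 : ∑ k, wLam lam U k = 2 := by
    simp only [h, Matrix.mulVec, dotProduct]
    rw [Finset.sum_comm]
    simp_rw [← Finset.sum_mul, hL, ← Finset.mul_sum, hW, mul_one]
  have hr : rowMarginal (jointP lam U) = fun k => 1 / 2 * wLam lam U k :=
    funext (rowMarginal_jointP h)
  have hc : colMarginal (jointP lam U) = wVec U := funext (colMarginal_jointP hlam U)
  have hE : (shannon fun z : Fin (2 * N) × Fin N => jointP lam U z.1 z.2) =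
      Real.log 2 + shannon lam + shannon (wVec U) := by
    have h2 : Real.negMulLog (1 / 2) = 1 / 2 * Real.log 2 := by
      simp [Real.negMulLog, Real.log_inv]
    -- Column `j` of `P` is `W_j / 2` times two copies of `λ`, so the chain rule for `negMulLog` of
    -- a product separates the three factors.
    have hcol : ∀ j, ∑ k, Real.negMulLog (jointP lam U k j) =
        (Real.log 2 + shannon lam) * wVec U j + Real.negMulLog (wVec U j) := fun j => by
      simp only [jointP_apply, Real.negMulLog_mul, h2, Finset.sum_add_distrib, ← Finset.sum_mul,
        ← Finset.mul_sum, hL, sum_lamMatrix Real.negMulLog]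
      rw [shannon]; ring
    rw [shannon, Fintype.sum_prod_type_right]
    simp only [hcol, Finset.sum_add_distrib, ← Finset.mul_sum, hW]
    rw [shannon, shannon]; ring
  rw [mutualInfo, hr, hc, hE, shannon_half hw2]
  ring

/-! ### The numbers `s_k` -/

section sCoeff

variable {N : ℕ}

theorem subNorm_nonneg (U : Matrix (Fin N) (Fin N) ℂ) (R C : Finset (Fin N)) :
    0 ≤ subNorm U R C := norm_nonneg _

/-- Passing from vectors on the subtype `C` to functions on all of `Fin N` makes submatrices of
different shapes comparable. -/
theorem norm_sq_toEuclideanLin_submatrix (U : Matrix (Fin N) (Fin N) ℂ) (R C : Finset (Fin N))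
    (v : EuclideanSpace ℂ C) (b : Fin N → ℂ) (hb : ∀ j : C, v j = b j) :
    ‖Matrix.toEuclideanLin (U.submatrix (Subtype.val : R → Fin N) (Subtype.val : C → Fin N)) v‖ ^ 2
      = ∑ i ∈ R, ‖∑ j ∈ C, U i j * b j‖ ^ 2 := by
  rw [EuclideanSpace.norm_sq_eq, ← Finset.sum_coe_sort R]
  refine Finset.sum_congr rfl fun i _ => ?_
  rw [← Finset.sum_coe_sort C]
  simp [Matrix.mulVec, dotProduct, hb]

theorem sum_norm_sq_le_subNorm (U : Matrix (Fin N) (Fin N) ℂ) (R C : Finset (Fin N))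
    (b : Fin N → ℂ) :
    ∑ i ∈ R, ‖∑ j ∈ C, U i j * b j‖ ^ 2 ≤ subNorm U R C ^ 2 * ∑ j ∈ C, ‖b j‖ ^ 2 := by
  let v : EuclideanSpace ℂ C := WithLp.toLp 2 fun j => b j
  have h := (LinearMap.toContinuousLinearMap (Matrix.toEuclideanLin
    (U.submatrix (Subtype.val : R → Fin N) (Subtype.val : C → Fin N)))).le_opNorm v
  have hv : ‖v‖ ^ 2 = ∑ j ∈ C, ‖b j‖ ^ 2 := by
    rw [EuclideanSpace.norm_sq_eq, ← Finset.sum_coe_sort C]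
  rw [← norm_sq_toEuclideanLin_submatrix U R C v b fun _ => rfl, ← hv, ← mul_pow]
  exact pow_le_pow_left₀ (norm_nonneg _) h 2

theorem subNorm_le (U : Matrix (Fin N) (Fin N) ℂ) (R C : Finset (Fin N)) {c : ℝ} (hc : 0 ≤ c)
    (h : ∀ b : Fin N → ℂ,
      ∑ i ∈ R, ‖∑ j ∈ C, U i j * b j‖ ^ 2 ≤ c ^ 2 * ∑ j ∈ C, ‖b j‖ ^ 2) :
    subNorm U R C ≤ c := by
  refine ContinuousLinearMap.opNorm_le_bound _ hc fun v => ?_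
  let b : Fin N → ℂ := fun j => if hj : j ∈ C then v ⟨j, hj⟩ else 0
  have hb : ∀ j : C, v j = b j := fun j => by simp [b]
  have hv : ‖v‖ ^ 2 = ∑ j ∈ C, ‖b j‖ ^ 2 := by
    rw [EuclideanSpace.norm_sq_eq, ← Finset.sum_coe_sort C]
    exact Finset.sum_congr rfl fun j _ => by rw [hb]
  refine le_of_sq_le_sq ?_ (by positivity)
  rw [mul_pow, hv]
  exact (norm_sq_toEuclideanLin_submatrix U R C v b hb).trans_le (h b)

theorem subNorm_mono (U : Matrix (Fin N) (Fin N) ℂ) {R R' C C' : Finset (Fin N)} (hR : R ⊆ R')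
    (hC : C ⊆ C') : subNorm U R C ≤ subNorm U R' C' := by
  refine subNorm_le U R C (subNorm_nonneg _ _ _) fun b => ?_
  have h := sum_norm_sq_le_subNorm U R' C' fun j => if j ∈ C then b j else 0
  have h1 : ∀ i, ∑ j ∈ C', U i j * (if j ∈ C then b j else 0) = ∑ j ∈ C, U i j * b j := fun i => by
    simp_rw [mul_ite, mul_zero]
    rw [← Finset.sum_filter, Finset.filter_mem_eq_inter, Finset.inter_eq_right.2 hC]
  have h2 : ∑ j ∈ C', ‖if j ∈ C then b j else 0‖ ^ 2 = ∑ j ∈ C, ‖b j‖ ^ 2 := by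
    rw [← Finset.inter_eq_right.2 hC, ← Finset.filter_mem_eq_inter, Finset.sum_filter]
    refine Finset.sum_congr rfl fun j hj => ?_
    split_ifs <;> simp_all
  simp only [h1, h2] at h
  exact (Finset.sum_le_sum_of_subset_of_nonneg hR fun _ _ _ => by positivity).trans h

theorem sCoeff_nonneg (U : Matrix (Fin N) (Fin N) ℂ) (k : ℕ) : 0 ≤ sCoeff U k := by
  refine Real.sSup_nonneg ?_
  rintro t ⟨R, C, -, -, -, rfl⟩
  exact subNorm_nonneg _ _ _

theorem sCoeff_zero (U : Matrix (Fin N) (Fin N) ℂ) : sCoeff U 0 = 0 := by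
  rw [sCoeff]
  convert Real.sSup_empty
  refine Set.eq_empty_of_forall_notMem ?_
  rintro t ⟨R, C, hR, hC, h, -⟩
  have := hR.card_pos
  have := hC.card_pos
  omega

/-- The matrix of inner products of the vectors of two orthonormal bases. -/
noncomputable def overlap {H : Type*} [NormedAddCommGroup H] [InnerProductSpace ℂ H]
    (x y : OrthonormalBasis (Fin N) ℂ H) : Matrix (Fin N) (Fin N) ℂ :=
  Matrix.of fun i j => inner ℂ (x i) (y j)

variable {H : Type*} [NormedAddCommGroup H] [InnerProductSpace ℂ H]

theorem norm_sq_sum_smul (y : OrthonormalBasis (Fin N) ℂ H) (C : Finset (Fin N)) (b : Fin N → ℂ) :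
    ‖∑ j ∈ C, b j • y j‖ ^ 2 = ∑ j ∈ C, ‖b j‖ ^ 2 := by
  have h : (inner ℂ (∑ j ∈ C, b j • y j) (∑ j ∈ C, b j • y j) : ℂ) = ∑ j ∈ C, ‖b j‖ ^ 2 := by
    rw [y.orthonormal.inner_sum]
    simp [RCLike.conj_mul]
  rw [norm_sq_eq_re_inner (𝕜 := ℂ), h]
  norm_cast

theorem inner_sum_smul (x y : OrthonormalBasis (Fin N) ℂ H) (C : Finset (Fin N)) (b : Fin N → ℂ)
    (i : Fin N) : inner ℂ (x i) (∑ j ∈ C, b j • y j) = ∑ j ∈ C, overlap x y i j * b j := by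
  simp [overlap, mul_comm]

theorem subNorm_overlap_le_one (x y : OrthonormalBasis (Fin N) ℂ H) (R C : Finset (Fin N)) :
    subNorm (overlap x y) R C ≤ 1 := by
  refine subNorm_le _ R C zero_le_one fun b => ?_
  rw [one_pow, one_mul, ← norm_sq_sum_smul y C b]
  simp_rw [← inner_sum_smul]
  exact x.orthonormal.sum_inner_products_le _

theorem one_le_subNorm_overlap (x y : OrthonormalBasis (Fin N) ℂ H) {R : Finset (Fin N)}
    (hR : R.Nonempty) : 1 ≤ subNorm (overlap x y) R Finset.univ := by
  obtain ⟨i, hi⟩ := hR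
  -- The test vector is the conjugate of row `i` of `U`: it has norm one, and its image has entry
  -- `1` in row `i`.
  have h := sum_norm_sq_le_subNorm (overlap x y) R Finset.univ fun j => inner ℂ (y j) (x i)
  have h1 : ∑ j, ‖inner ℂ (y j) (x i)‖ ^ 2 = 1 := by
    rw [y.sum_sq_norm_inner_right, x.norm_eq_one, one_pow]
  have h2 : ∑ j, overlap x y i j * inner ℂ (y j) (x i) = 1 := by
    simp only [overlap, Matrix.of_apply]
    rw [y.sum_inner_mul_inner, inner_self_eq_norm_sq_to_K, x.norm_eq_one]; simp
  have h3 := Finset.single_le_sum (s := R)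
    (f := fun i' => ‖∑ j, overlap x y i' j * inner ℂ (y j) (x i)‖ ^ 2)
    (fun _ _ => by positivity) hi
  simp only [h2, norm_one, one_pow] at h3
  rw [h1, mul_one] at h
  have := subNorm_nonneg (overlap x y) R Finset.univ
  nlinarith

theorem subNorm_le_sCoeff (x y : OrthonormalBasis (Fin N) ℂ H) {R C : Finset (Fin N)}
    (hR : R.Nonempty) (hC : C.Nonempty) :
    subNorm (overlap x y) R C ≤ sCoeff (overlap x y) (R.card + C.card - 1) := by
  refine le_csSup ⟨1, ?_⟩ ⟨R, C, hR, hC, ?_, rfl⟩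
  · rintro t ⟨R, C, -, -, -, rfl⟩
    exact subNorm_overlap_le_one x y R C
  · have := hR.card_pos
    omega

theorem sCoeff_le_one (x y : OrthonormalBasis (Fin N) ℂ H) (k : ℕ) :
    sCoeff (overlap x y) k ≤ 1 := by
  refine Real.sSup_le ?_ zero_le_one
  rintro t ⟨R, C, -, -, -, rfl⟩
  exact subNorm_overlap_le_one x y R C

theorem sCoeff_eq_one (x y : OrthonormalBasis (Fin N) ℂ H) {k : ℕ} (hk : N ≤ k)
    (hk2 : k < 2 * N) : sCoeff (overlap x y) k = 1 := by
  refine le_antisymm (sCoeff_le_one x y k) ?_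
  obtain ⟨R, -, hR⟩ := Finset.exists_subset_card_eq (s := (Finset.univ : Finset (Fin N)))
    (n := k + 1 - N) (by simp; omega)
  have hR0 : R.Nonempty := Finset.card_pos.1 (by omega)
  have hC0 : (Finset.univ : Finset (Fin N)).Nonempty := ⟨⟨0, by omega⟩, Finset.mem_univ _⟩
  have h := subNorm_le_sCoeff x y hR0 hC0
  rw [hR, Finset.card_univ, Fintype.card_fin, show k + 1 - N + N - 1 = k by omega] at h
  exact (one_le_subNorm_overlap x y hR0).trans h

/-- A submatrix that is not all of `U` can be enlarged by a row or a column, which does not decrease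
its norm. -/
theorem sCoeff_le_succ (x y : OrthonormalBasis (Fin N) ℂ H) {k : ℕ} (hk : k + 1 < 2 * N) :
    sCoeff (overlap x y) k ≤ sCoeff (overlap x y) (k + 1) := by
  refine Real.sSup_le ?_ (sCoeff_nonneg _ _)
  rintro t ⟨R, C, hR, hC, h, rfl⟩
  by_cases hRu : R = Finset.univ
  · have hCu : C ≠ Finset.univ := by
      rintro rfl
      rw [hRu, Finset.card_univ, Fintype.card_fin] at h
      omega
    obtain ⟨j, hj⟩ : ∃ j, j ∉ C := by
      by_contra! hj; exact hCu (Finset.eq_univ_of_forall hj)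
    have h1 := subNorm_le_sCoeff x y hR (Finset.insert_nonempty j C)
    rw [Finset.card_insert_of_notMem hj, show R.card + (C.card + 1) - 1 = k + 1 by omega] at h1
    exact (subNorm_mono _ subset_rfl (Finset.subset_insert j C)).trans h1
  · obtain ⟨i, hi⟩ : ∃ i, i ∉ R := by
      by_contra! hi; exact hRu (Finset.eq_univ_of_forall hi)
    have h1 := subNorm_le_sCoeff x y (Finset.insert_nonempty i R) hC
    rw [Finset.card_insert_of_notMem hi, show R.card + 1 + C.card - 1 = k + 1 by omega] at h1
    exact (subNorm_mono _ (Finset.subset_insert i R) subset_rfl).trans h1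

theorem wVec_nonneg (x y : OrthonormalBasis (Fin N) ℂ H) (j : Fin N) :
    0 ≤ wVec (overlap x y) j := by
  rw [wVec, sub_nonneg]
  rcases Nat.lt_or_ge ((j : ℕ) + 1) (2 * N) with h | h
  · exact sCoeff_le_succ x y h
  · omega

/-- The bilinear form of `U` on vectors supported in `C` and `R`. -/
theorem norm_inner_sum_smul_le (x y : OrthonormalBasis (Fin N) ℂ H) (R C : Finset (Fin N))
    (a b : Fin N → ℂ) :
    ‖(inner ℂ (∑ i ∈ R, a i • x i) (∑ j ∈ C, b j • y j) : ℂ)‖ ≤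
      sCoeff (overlap x y) (R.card + C.card - 1) *
        (‖∑ i ∈ R, a i • x i‖ * ‖∑ j ∈ C, b j • y j‖) := by
  rcases R.eq_empty_or_nonempty with rfl | hR
  · simp
  rcases C.eq_empty_or_nonempty with rfl | hC
  · simp
  refine le_trans ?_ (mul_le_mul_of_nonneg_right (subNorm_le_sCoeff x y hR hC) (by positivity))
  have h := sum_norm_sq_le_subNorm (overlap x y) R C b
  have h1 : (inner ℂ (∑ i ∈ R, a i • x i) (∑ j ∈ C, b j • y j) : ℂ) =
      ∑ i ∈ R, (starRingEnd ℂ) (a i) * ∑ j ∈ C, overlap x y i j * b j := by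
    rw [sum_inner]
    exact Finset.sum_congr rfl fun i _ => by rw [inner_smul_left, inner_sum_smul]
  refine le_of_sq_le_sq ?_ (by have := subNorm_nonneg (overlap x y) R C; positivity)
  rw [mul_pow, mul_pow, norm_sq_sum_smul, norm_sq_sum_smul, h1]
  have h2 : ‖∑ i ∈ R, (starRingEnd ℂ) (a i) * ∑ j ∈ C, overlap x y i j * b j‖ ≤
      ∑ i ∈ R, ‖a i‖ * ‖∑ j ∈ C, overlap x y i j * b j‖ :=
    (norm_sum_le _ _).trans_eq (Finset.sum_congr rfl fun i _ => by
      rw [norm_mul, RCLike.norm_conj])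
  have h3 := Finset.sum_mul_sq_le_sq_mul_sq R (fun i => ‖a i‖)
    fun i => ‖∑ j ∈ C, overlap x y i j * b j‖
  have h4 := mul_le_mul_of_nonneg_left h
    (Finset.sum_nonneg fun i (_ : i ∈ R) => sq_nonneg ‖a i‖)
  calc _ ≤ (∑ i ∈ R, ‖a i‖ * ‖∑ j ∈ C, overlap x y i j * b j‖) ^ 2 :=
        pow_le_pow_left₀ (norm_nonneg _) h2 2
    _ ≤ _ := h3
    _ ≤ _ := h4
    _ = _ := by ring

end sCoeff

/-! ### Majorization of the outcome probabilities -/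

theorem sum_norm_sq_apply_eq_adjoint {E H ι κ : Type*} [NormedAddCommGroup E]
    [InnerProductSpace ℂ E] [FiniteDimensional ℂ E] [NormedAddCommGroup H] [InnerProductSpace ℂ H]
    [FiniteDimensional ℂ H] [Fintype ι] [Fintype κ] (A : E →ₗ[ℂ] H)
    (u : OrthonormalBasis ι ℂ E) (b : OrthonormalBasis κ ℂ H) :
    ∑ i, ‖A (u i)‖ ^ 2 = ∑ j, ‖LinearMap.adjoint A (b j)‖ ^ 2 := by
  have h1 : ∀ i, ‖A (u i)‖ ^ 2 = ∑ j, ‖inner ℂ (b j) (A (u i))‖ ^ 2 := fun i =>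
    (b.sum_sq_norm_inner_right _).symm
  have h2 : ∀ j, ‖LinearMap.adjoint A (b j)‖ ^ 2 = ∑ i, ‖inner ℂ (b j) (A (u i))‖ ^ 2 :=
    fun j => by
      rw [← u.sum_sq_norm_inner_left]
      simp_rw [LinearMap.adjoint_inner_left]
  simp_rw [h1, h2]
  exact Finset.sum_comm

/-- The Hilbert–Schmidt norm does not depend on the orthonormal basis. -/
theorem sum_norm_sq_apply_eq {E H ι κ : Type*} [NormedAddCommGroup E] [InnerProductSpace ℂ E]
    [FiniteDimensional ℂ E] [NormedAddCommGroup H] [InnerProductSpace ℂ H]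
    [FiniteDimensional ℂ H] [Fintype ι] [Fintype κ] (A : E →ₗ[ℂ] H)
    (u : OrthonormalBasis ι ℂ E) (v : OrthonormalBasis κ ℂ E) :
    ∑ i, ‖A (u i)‖ ^ 2 = ∑ i, ‖A (v i)‖ ^ 2 :=
  (sum_norm_sq_apply_eq_adjoint A u (stdOrthonormalBasis ℂ H)).trans
    (sum_norm_sq_apply_eq_adjoint A v (stdOrthonormalBasis ℂ H)).symm

/-- An orthonormal family can be rotated within its span so that a given linear functional vanishes
on all its members but the first. -/
theorem exists_rotate {E H : Type*} [NormedAddCommGroup E] [InnerProductSpace ℂ E]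
    [NormedAddCommGroup H] [InnerProductSpace ℂ H] [FiniteDimensional ℂ H] {m : ℕ}
    (A : E →ₗ[ℂ] H) (φ : E →ₗ[ℂ] ℂ) {v : Fin (m + 1) → E} (hv : Orthonormal ℂ v) :
    ∃ v' : Fin (m + 1) → E, Orthonormal ℂ v' ∧ (∀ i, v' i ∈ Submodule.span ℂ (Set.range v)) ∧
      (∀ i : Fin m, φ (v' i.succ) = 0) ∧ ∑ i, ‖A (v i)‖ ^ 2 = ∑ i, ‖A (v' i)‖ ^ 2 := by
  let F := EuclideanSpace ℂ (Fin (m + 1))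
  let L : F →ₗ[ℂ] E := (Fintype.linearCombination ℂ v) ∘ₗ (WithLp.linearEquiv 2 ℂ _).toLinearMap
  have hL : ∀ z : F, L z = ∑ i, z i • v i := fun z => by
    simp only [L, LinearMap.comp_apply, Fintype.linearCombination_apply]
    rfl
  have hLi : ∀ z z' : F, inner ℂ (L z) (L z') = inner ℂ z z' := fun z z' => by
    rw [hL, hL, hv.inner_sum, PiLp.inner_apply]
    exact Finset.sum_congr rfl fun i _ => by simp [mul_comm]
  have hLs : ∀ i, L (EuclideanSpace.basisFun _ ℂ i) = v i := fun i => by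
    rw [hL]; simp
  let w : F := WithLp.toLp 2 fun i => starRingEnd ℂ (φ (v i))
  have hw : ∀ z, φ (L z) = inner ℂ w z := fun z => by
    rw [hL, PiLp.inner_apply, map_sum]
    exact Finset.sum_congr rfl fun i _ => by simp [w]
  -- The vector `w` represents `φ` on the span. A basis whose first member is `w / ‖w‖` has all its
  -- other members in the kernel.
  obtain ⟨u, hu⟩ : ∃ u : OrthonormalBasis (Fin (m + 1)) ℂ F, ∀ i : Fin m,
      inner ℂ w (u i.succ) = 0 := by
    by_cases h0 : w = 0
    · exact ⟨EuclideanSpace.basisFun _ ℂ, fun i => by rw [h0, inner_zero_left]⟩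
    · have ho : Orthonormal ℂ
          (({0} : Set (Fin (m + 1))).domRestrict fun _ => ((‖w‖⁻¹ : ℝ) : ℂ) • w) := by
        refine ⟨fun i => ?_, fun i j hij => absurd (Subsingleton.elim i j) hij⟩
        have h1 : ‖w‖ ≠ 0 := norm_ne_zero_iff.2 h0
        change ‖((‖w‖⁻¹ : ℝ) : ℂ) • w‖ = 1
        rw [norm_smul, Complex.norm_real, norm_inv, norm_norm, inv_mul_cancel₀ h1]
      obtain ⟨u, hu⟩ := ho.exists_orthonormalBasis_extension_of_card_eq
        (by simp [F])
      refine ⟨u, fun i => ?_⟩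
      have h1 : inner ℂ (u 0) (u i.succ) = 0 := u.orthonormal.2 (Fin.succ_ne_zero i).symm
      rw [hu 0 rfl, inner_smul_left, mul_eq_zero] at h1
      exact h1.resolve_left (by
        rw [map_eq_zero, Complex.ofReal_eq_zero, inv_eq_zero]
        exact norm_ne_zero_iff.2 h0)
  refine ⟨fun i => L (u i), ?_, fun i => ?_, fun i => by rw [hw, hu], ?_⟩
  · rw [orthonormal_iff_ite]
    intro i j
    rw [hLi]
    exact orthonormal_iff_ite.1 u.orthonormal i j
  · simp only [hL]
    exact Submodule.sum_mem _ fun j _ =>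
      Submodule.smul_mem _ _ (Submodule.subset_span (Set.mem_range_self j))
  · refine Eq.trans ?_ (sum_norm_sq_apply_eq (A ∘ₗ L) (EuclideanSpace.basisFun _ ℂ) u)
    exact Finset.sum_congr rfl fun i _ => by rw [LinearMap.comp_apply, hLs]

/-! ### Ky Fan bounds for vectors chosen from two orthonormal bases -/

section Majorization

variable {N : ℕ} {H : Type*} [NormedAddCommGroup H] [InnerProductSpace ℂ H]

/-- The operator `v ↦ ∑ i, v i x i + ∑ j, v j y j`. -/
noncomputable def synthesis (x y : OrthonormalBasis (Fin N) ℂ H) :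
    EuclideanSpace ℂ (Fin N ⊕ Fin N) →ₗ[ℂ] H :=
  (Fintype.linearCombination ℂ (Sum.elim x y)) ∘ₗ (WithLp.linearEquiv 2 ℂ _).toLinearMap

theorem synthesis_apply (x y : OrthonormalBasis (Fin N) ℂ H)
    (v : EuclideanSpace ℂ (Fin N ⊕ Fin N)) :
    synthesis x y v = ∑ i, v (Sum.inl i) • x i + ∑ j, v (Sum.inr j) • y j := by
  simp [synthesis, Fintype.linearCombination_apply]

/-- The sign change of the second half of the coordinates. -/
noncomputable def signFlip (v : EuclideanSpace ℂ (Fin N ⊕ Fin N)) :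
    EuclideanSpace ℂ (Fin N ⊕ Fin N) :=
  WithLp.toLp 2 (Sum.elim (fun i => v (Sum.inl i)) fun j => -v (Sum.inr j))

theorem inner_signFlip (v w : EuclideanSpace ℂ (Fin N ⊕ Fin N)) :
    inner ℂ (signFlip v) (signFlip w) = inner ℂ v w := by
  simp [signFlip, PiLp.inner_apply]

theorem norm_sq_eq_add (x y : OrthonormalBasis (Fin N) ℂ H)
    (v : EuclideanSpace ℂ (Fin N ⊕ Fin N)) :
    ‖∑ i, v (Sum.inl i) • x i‖ ^ 2 + ‖∑ j, v (Sum.inr j) • y j‖ ^ 2 = ‖v‖ ^ 2 := by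
  rw [norm_sq_sum_smul, norm_sq_sum_smul, EuclideanSpace.norm_sq_eq, Fintype.sum_sum_type]

/-- The sign flip exchanges the eigenvalues `1 + σ` and `1 - σ` of the Gram matrix. This turns upper
bounds into the lower bounds needed on an orthogonal complement. -/
theorem norm_sq_synthesis_add_signFlip (x y : OrthonormalBasis (Fin N) ℂ H)
    (v : EuclideanSpace ℂ (Fin N ⊕ Fin N)) :
    ‖synthesis x y v‖ ^ 2 + ‖synthesis x y (signFlip v)‖ ^ 2 = 2 * ‖v‖ ^ 2 := by
  rw [← norm_sq_eq_add x y, synthesis_apply, synthesis_apply]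
  simp only [signFlip, Sum.elim_inl, Sum.elim_inr, neg_smul, Finset.sum_neg_distrib,
    ← sub_eq_add_neg]
  have := parallelogram_law_with_norm ℂ (∑ i, v (Sum.inl i) • x i) (∑ j, v (Sum.inr j) • y j)
  nlinarith

theorem norm_sq_synthesis_le (x y : OrthonormalBasis (Fin N) ℂ H) {I : Finset (Fin N ⊕ Fin N)}
    {v : EuclideanSpace ℂ (Fin N ⊕ Fin N)} (hv : ‖v‖ = 1) (hI : ∀ a, a ∉ I → v a = 0) :
    ‖synthesis x y v‖ ^ 2 ≤ 1 + sCoeff (overlap x y) (I.card - 1) := by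
  have hR : ∑ i, v (Sum.inl i) • x i = ∑ i ∈ I.toLeft, v (Sum.inl i) • x i := by
    symm
    refine Finset.sum_subset (Finset.subset_univ _) fun i _ hi => ?_
    rw [hI _ (by simpa using hi), zero_smul]
  have hC : ∑ j, v (Sum.inr j) • y j = ∑ j ∈ I.toRight, v (Sum.inr j) • y j := by
    symm
    refine Finset.sum_subset (Finset.subset_univ _) fun i _ hi => ?_
    rw [hI _ (by simpa using hi), zero_smul]
  have h1 := norm_inner_sum_smul_le x y I.toLeft I.toRight (fun i => v (Sum.inl i))
    fun j => v (Sum.inr j)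
  rw [← hR, ← hC, Finset.card_toLeft_add_card_toRight] at h1
  have h2 := norm_sq_eq_add x y v
  rw [hv] at h2
  rw [synthesis_apply, norm_add_sq (𝕜 := ℂ)]
  have h3 := RCLike.re_le_norm (inner ℂ (∑ i, v (Sum.inl i) • x i) (∑ j, v (Sum.inr j) • y j) : ℂ)
  have h4 := sCoeff_nonneg (overlap x y) (I.card - 1)
  -- The cross term is at most `2s‖u‖‖v‖ ≤ s(‖u‖² + ‖v‖²) = s` for the two components `u` and `v`.
  have h5 := sq_nonneg (‖∑ i, v (Sum.inl i) • x i‖ - ‖∑ j, v (Sum.inr j) • y j‖)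
  have h6 : 2 * (‖∑ i, v (Sum.inl i) • x i‖ * ‖∑ j, v (Sum.inr j) • y j‖) ≤ 1 := by nlinarith
  have h7 := mul_le_mul_of_nonneg_left h6 h4
  linarith

/-- Extension by zero of a vector with coordinates in `I`. -/
noncomputable def extendZero {α : Type*} [DecidableEq α] (I : Finset α) :
    EuclideanSpace ℂ I →ₗ[ℂ] EuclideanSpace ℂ α where
  toFun v := WithLp.toLp 2 fun a => if h : a ∈ I then v ⟨a, h⟩ else 0
  map_add' v w := by ext a; by_cases h : a ∈ I <;> simp [h]
  map_smul' c v := by ext a; by_cases h : a ∈ I <;> simp [h]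

theorem extendZero_apply_of_notMem {α : Type*} [DecidableEq α] (I : Finset α)
    (v : EuclideanSpace ℂ I) {a : α} (h : a ∉ I) : extendZero I v a = 0 := by
  simp [extendZero, h]

theorem extendZero_apply_coe {α : Type*} [DecidableEq α] (I : Finset α)
    (v : EuclideanSpace ℂ I) (a : I) : extendZero I v a = v a := by
  simp [extendZero]

theorem inner_extendZero {α : Type*} [Fintype α] [DecidableEq α] (I : Finset α)
    (v w : EuclideanSpace ℂ I) : inner ℂ (extendZero I v) (extendZero I w) = inner ℂ v w := by
  rw [PiLp.inner_apply, PiLp.inner_apply,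
    ← Finset.sum_subset (Finset.subset_univ I) fun a _ ha => by
      rw [extendZero_apply_of_notMem I v ha, inner_zero_left],
    ← Finset.sum_coe_sort I]
  simp only [extendZero_apply_coe]

theorem synthesis_extendZero (x y : OrthonormalBasis (Fin N) ℂ H) (I : Finset (Fin N ⊕ Fin N))
    (v : EuclideanSpace ℂ I) :
    synthesis x y (extendZero I v) = ∑ a : I, v a • Sum.elim x y a := by
  have h : synthesis x y (extendZero I v) = ∑ a, extendZero I v a • Sum.elim x y a := by
    simp [synthesis, Fintype.linearCombination_apply]
  rw [h, ← Finset.sum_subset (Finset.subset_univ I) fun a _ ha => by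
      rw [extendZero_apply_of_notMem I v ha, zero_smul], ← Finset.sum_coe_sort I]
  simp only [extendZero_apply_coe]

theorem orthonormal_of_inner {E F ι : Type*} [NormedAddCommGroup E] [InnerProductSpace ℂ E]
    [NormedAddCommGroup F] [InnerProductSpace ℂ F] {v : ι → E} (hv : Orthonormal ℂ v) {f : E → F}
    (hf : ∀ a b, inner ℂ (f a) (f b) = inner ℂ a b) : Orthonormal ℂ fun i => f (v i) := by
  classical
  rw [orthonormal_iff_ite] at hv ⊢
  intro i j
  rw [hf, hv]

variable [FiniteDimensional ℂ H]

/-- Interlacing without eigenvalues: the family is rotated so that all members but the first vanish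
at a coordinate `c ∈ I`. The first contributes at most `1 + s_{|I|-1}`, and induction applies to the
others with support in `I \ {c}`. -/
theorem sum_norm_sq_synthesis_le (x y : OrthonormalBasis (Fin N) ℂ H) (m : ℕ)
    (I : Finset (Fin N ⊕ Fin N)) {v : Fin m → EuclideanSpace ℂ (Fin N ⊕ Fin N)}
    (hv : Orthonormal ℂ v) (hI : ∀ i, ∀ a, a ∉ I → v i a = 0) :
    ∑ i, ‖synthesis x y (v i)‖ ^ 2 ≤
      m + ∑ i ∈ Finset.range m, sCoeff (overlap x y) (I.card - 1 - i) := by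
  induction m generalizing I with
  | zero => simp
  | succ m ih =>
    obtain ⟨c, hc⟩ : I.Nonempty := by
      by_contra h
      rw [Finset.not_nonempty_iff_eq_empty] at h
      have h0 : v 0 = 0 := by
        ext a; exact hI 0 a (by simp [h])
      have h1 := hv.1 0
      rw [h0, norm_zero] at h1
      exact zero_ne_one h1
    let φ : EuclideanSpace ℂ (Fin N ⊕ Fin N) →ₗ[ℂ] ℂ :=
      (EuclideanSpace.proj c : EuclideanSpace ℂ (Fin N ⊕ Fin N) →L[ℂ] ℂ).toLinearMap
    obtain ⟨v', hv', hspan, hφ, hsum⟩ := exists_rotate (synthesis x y) φ hv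
    have hI' : ∀ i, ∀ a, a ∉ I → v' i a = 0 := fun i a ha => by
      have hle : Submodule.span ℂ (Set.range v) ≤ LinearMap.ker
          (EuclideanSpace.proj a : EuclideanSpace ℂ (Fin N ⊕ Fin N) →L[ℂ] ℂ).toLinearMap := by
        rw [Submodule.span_le]
        rintro _ ⟨j, rfl⟩
        exact hI j a ha
      exact hle (hspan i)
    have h1 := ih (I.erase c) (v := fun i => v' i.succ)
      (hv'.comp _ (Fin.succ_injective m)) fun i a ha => by
        by_cases hac : a = c
        · rw [hac]; exact hφ i
        · exact hI' _ a fun h => ha (Finset.mem_erase.2 ⟨hac, h⟩)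
    have h2 := norm_sq_synthesis_le x y (hv'.1 0) (hI' 0)
    rw [Finset.card_erase_of_mem hc] at h1
    rw [hsum, Fin.sum_univ_succ, Finset.sum_range_succ']
    have h3 : ∀ i, I.card - 1 - 1 - i = I.card - 1 - (i + 1) := fun i => by omega
    simp only [h3] at h1
    rw [Nat.sub_zero]
    push_cast
    linarith

/-- The sum of the squared lengths of the images of an orthonormal family; both the family and its
orthogonal complement are taken into account. -/
theorem sum_norm_sq_synthesis_le_kyFanBound (x y : OrthonormalBasis (Fin N) ℂ H) {g : ℕ}
    (I : Finset (Fin N ⊕ Fin N)) {z : Fin g → EuclideanSpace ℂ I} (hz : Orthonormal ℂ z) :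
    ∑ i, ‖synthesis x y (extendZero I (z i))‖ ^ 2 ≤ kyFanBound (sCoeff (overlap x y)) I.card g := by
  have hg : g ≤ I.card := by
    simpa using hz.linearIndependent.fintype_card_le_finrank
  obtain ⟨r, hr⟩ := Nat.exists_eq_add_of_le hg
  have h1 : ∑ i, ‖synthesis x y (extendZero I (z i))‖ ^ 2 ≤
      g + ∑ i ∈ Finset.range g, sCoeff (overlap x y) (I.card - 1 - i) :=
    sum_norm_sq_synthesis_le x y g I (orthonormal_of_inner hz (inner_extendZero I))
      fun i a ha => extendZero_apply_of_notMem I _ ha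
  -- The family is completed to a basis of `ℂ^I` by `r` vectors. The trace is `|I| = g + r`, and the
  -- sign flip shows that the `r` new vectors contribute at least `r - ∑_{i<r} s_{|I|-1-i}`.
  have h2 : ∑ i, ‖synthesis x y (extendZero I (z i))‖ ^ 2 ≤
      g + ∑ i ∈ Finset.range r, sCoeff (overlap x y) (I.card - 1 - i) := by
    have ho : Orthonormal ℂ ((Set.range (Fin.castAdd r : Fin g → Fin (g + r))).domRestrict
        (Fin.append z 0)) := by
      classical
      rw [orthonormal_iff_ite] at hz ⊢
      rintro ⟨_, i, rfl⟩ ⟨_, j, rfl⟩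
      simp [Set.domRestrict, hz i j, Subtype.ext_iff]
    obtain ⟨b, hb⟩ := ho.exists_orthonormalBasis_extension_of_card_eq (by simp [hr])
    have htot : ∑ i, ‖synthesis x y (extendZero I (b i))‖ ^ 2 = I.card := by
      have h := sum_norm_sq_apply_eq (synthesis x y ∘ₗ extendZero I) b
        (EuclideanSpace.basisFun I ℂ)
      simp only [LinearMap.comp_apply] at h
      rw [h]
      have h1 : ∀ a : I, ‖synthesis x y (extendZero I (EuclideanSpace.basisFun I ℂ a))‖ ^ 2 =
          1 := fun a => by
        rw [synthesis_extendZero]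
        simp only [EuclideanSpace.basisFun_apply, PiLp.single_apply, ite_smul, one_smul, zero_smul,
          Finset.sum_ite_eq', Finset.mem_univ, if_true]
        rcases a with ⟨a | a, ha⟩ <;> simp
      rw [Finset.sum_congr rfl fun a _ => h1 a]
      simp
    rw [Fin.sum_univ_add] at htot
    have hb1 : ∀ i, b (Fin.castAdd r i) = z i := fun i => by
      rw [hb _ ⟨i, rfl⟩, Fin.append_left]
    have hb2 : Orthonormal ℂ fun i : Fin r => b (Fin.natAdd g i) :=
      b.orthonormal.comp _ (Fin.natAdd_injective r g)
    have hb3 := orthonormal_of_inner hb2 (inner_extendZero I)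
    have h3 := sum_norm_sq_synthesis_le x y r I (orthonormal_of_inner hb3 inner_signFlip)
      fun i a ha => by
        rcases a with a | a <;> simp [signFlip, extendZero_apply_of_notMem I _ ha]
    have h4 : ∀ i, ‖synthesis x y (signFlip (extendZero I (b (Fin.natAdd g i))))‖ ^ 2 =
        2 - ‖synthesis x y (extendZero I (b (Fin.natAdd g i)))‖ ^ 2 := fun i => by
      have h5 := norm_sq_synthesis_add_signFlip x y (extendZero I (b (Fin.natAdd g i)))
      rw [hb3.1 i] at h5
      linarith
    simp only [h4, hb1, Finset.sum_sub_distrib, Finset.sum_const, Finset.card_univ,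
      Fintype.card_fin, nsmul_eq_mul] at h3 htot
    have h6 : (I.card : ℝ) = g + r := by exact_mod_cast hr
    linarith
  unfold kyFanBound
  rw [min_eq_left hg, show I.card - g = r by omega]
  rcases le_total g r with h | h
  · rwa [min_eq_left h]
  · rwa [min_eq_right h]

/-- A Ky Fan type bound for the sum of the projections on the vectors indexed by `I`. -/
theorem sum_sum_norm_sq_inner_le (x y : OrthonormalBasis (Fin N) ℂ H) {m : ℕ}
    (I : Finset (Fin N ⊕ Fin N)) {e : Fin m → H} (he : Orthonormal ℂ e) :
    ∑ l, ∑ a ∈ I, ‖inner ℂ (Sum.elim x y a) (e l)‖ ^ 2 ≤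
      kyFanBound (sCoeff (overlap x y)) I.card m := by
  let w : Fin m → EuclideanSpace ℂ I := fun l =>
    WithLp.toLp 2 fun a => inner ℂ (Sum.elim x y (a : Fin N ⊕ Fin N)) (e l)
  -- The adjoint of the synthesis map on `ℂ^I` sends `e l` to `w l`. The sum is thus moved to a
  -- basis `b` of the span of the `w l`, and Bessel's inequality for `e` leaves the squared norms of
  -- the synthesized `b i`. The span may have dimension below `m`, so `kyFanBound_mono` is needed.
  let S := Submodule.span ℂ (Set.range w)
  let b := stdOrthonormalBasis ℂ S
  have hS : Module.finrank ℂ S ≤ m := by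
    have h := finrank_range_le_card (R := ℂ) w
    rwa [Fintype.card_fin] at h
  have hb : Orthonormal ℂ fun i => (b i : EuclideanSpace ℂ I) :=
    b.orthonormal.comp_linearIsometry S.subtypeₗᵢ
  have hw : ∀ l, ∑ a ∈ I, ‖inner ℂ (Sum.elim x y a) (e l)‖ ^ 2 =
      ∑ i, ‖inner ℂ (synthesis x y (extendZero I (b i))) (e l)‖ ^ 2 := fun l => by
    have h1 : ∑ a ∈ I, ‖inner ℂ (Sum.elim x y a) (e l)‖ ^ 2 = ‖w l‖ ^ 2 := by
      rw [EuclideanSpace.norm_sq_eq, ← Finset.sum_coe_sort I]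
    have hmem : w l ∈ S := Submodule.subset_span (Set.mem_range_self l)
    have h2 := b.sum_sq_norm_inner_right ⟨w l, hmem⟩
    rw [h1, show ‖w l‖ = ‖(⟨w l, hmem⟩ : S)‖ from rfl, ← h2]
    refine Finset.sum_congr rfl fun i _ => ?_
    rw [Submodule.coe_inner, synthesis_extendZero, sum_inner, PiLp.inner_apply]
    congr 2
    refine Finset.sum_congr rfl fun a _ => ?_
    rw [inner_smul_left]
    simp [w, mul_comm]
  simp_rw [hw]
  rw [Finset.sum_comm]
  refine le_trans (Finset.sum_le_sum fun i _ => ?_)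
    ((sum_norm_sq_synthesis_le_kyFanBound x y I hb).trans
      (kyFanBound_mono (sCoeff_nonneg _) (sCoeff_le_one x y) _ hS))
  refine le_of_eq_of_le ?_ (he.sum_inner_products_le (s := Finset.univ) _)
  exact Finset.sum_congr rfl fun l _ => by rw [norm_inner_symm]

theorem pad_antitone {lam : Fin N → ℝ} (hlam : Antitone lam) (h0 : ∀ i, 0 ≤ lam i) (i : ℕ) :
    pad lam (i + 1 + 1) ≤ pad lam (i + 1) := by
  by_cases h : i + 1 < N
  · rw [pad, pad, dif_pos (by omega), dif_pos (by omega)]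
    exact hlam (by simp)
  · rw [pad, dif_neg (by omega)]
    exact pad_nonneg h0 _

/-- The outcome probabilities of the two measurements are majorized by `W^{(λ)}`. -/
theorem sum_outcome_le_bigS (x y e : OrthonormalBasis (Fin N) ℂ H) {lam : Fin N → ℝ}
    (hlam : Antitone lam) (h0 : ∀ i, 0 ≤ lam i) (I : Finset (Fin N ⊕ Fin N)) :
    ∑ a ∈ I, ∑ l, lam l * ‖inner ℂ (Sum.elim x y a) (e l)‖ ^ 2 ≤
      bigS lam (overlap x y) I.card := by
  let t : ℕ → ℝ := fun i =>
    if h : i < N then ∑ a ∈ I, ‖inner ℂ (Sum.elim x y a) (e ⟨i, h⟩)‖ ^ 2 else 0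
  have hL : ∑ a ∈ I, ∑ l, lam l * ‖inner ℂ (Sum.elim x y a) (e l)‖ ^ 2 =
      ∑ i ∈ Finset.range N, pad lam (i + 1) * t i := by
    rw [Finset.sum_comm, Finset.sum_range]
    refine Finset.sum_congr rfl fun l _ => ?_
    rw [pad, dif_pos (by omega), ← Finset.mul_sum]
    simp [t]
  have hK : I.card ≤ 2 * N := by
    have := I.card_le_univ
    simp at this
    omega
  have hR : bigS lam (overlap x y) I.card = ∑ i ∈ Finset.range N,
      pad lam (i + 1) * sWeight (sCoeff (overlap x y)) I.card i := by
    rw [bigS_eq_sum_sWeight lam _ hK]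
    symm
    refine Finset.sum_subset (by simp; omega) fun i _ hi => ?_
    rw [pad, dif_neg (by simp at hi; omega), zero_mul]
  rw [hL, hR]
  -- Summation by parts replaces the decreasing weights `λ` by indicators of the first `m` indices.
  refine sum_mul_le_sum_mul_of_antitone (fun i _ => pad_antitone hlam h0 i)
    (fun i => pad_nonneg h0 _) fun m hm => ?_
  rw [sum_sWeight, Finset.sum_range]
  refine le_of_eq_of_le (Finset.sum_congr rfl fun i _ => ?_)
    (sum_sum_norm_sq_inner_le x y I (e.orthonormal.comp _ (Fin.castLE_injective hm)))
  simp only [t, dif_pos (i.2.trans_le hm)]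
  rfl

end Majorization

/-! ### Entropies of the states -/

/-- The sum of `- z ln z` over the roots of the characteristic polynomial. -/
noncomputable def rootEntropy {n : Type*} [Fintype n] [DecidableEq n] (A : Matrix n n ℂ) : ℝ :=
  (A.charpoly.roots.map fun z => Real.negMulLog z.re).sum

/-- The multiset of roots of the characteristic polynomial can be compared between matrices of
different sizes, which indexed eigenvalues cannot. -/
theorem vonNeumann_eq_rootEntropy {n : Type*} [Fintype n] [DecidableEq n] (ρ : DensityMatrix n) :
    vonNeumann ρ = rootEntropy ρ.mat := by
  rw [rootEntropy, ρ.posSemidef.isHermitian.roots_charpoly_eq_eigenvalues, Multiset.map_map,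
    vonNeumann, shannon]
  rfl

theorem rootEntropy_transpose {n : Type*} [Fintype n] [DecidableEq n] (A : Matrix n n ℂ) :
    rootEntropy A.transpose = rootEntropy A := by
  rw [rootEntropy, Matrix.charpoly_transpose, rootEntropy]

theorem rootEntropy_diagonal {n : Type*} [Fintype n] [DecidableEq n] (d : n → ℂ) :
    rootEntropy (Matrix.diagonal d) = shannon fun i => (d i).re := by
  rw [rootEntropy, Matrix.charpoly_diagonal, Polynomial.roots_prod _ _
    (Finset.prod_ne_zero_iff.2 fun i _ => Polynomial.X_sub_C_ne_zero _)]
  simp [shannon]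

/-- The products `A B` and `B A` have the same nonzero eigenvalues. -/
theorem rootEntropy_mul_comm {m n : Type*} [Fintype m] [DecidableEq m] [Fintype n] [DecidableEq n]
    (A : Matrix m n ℂ) (B : Matrix n m ℂ) : rootEntropy (A * B) = rootEntropy (B * A) := by
  -- The two characteristic polynomials agree up to powers of `X`, and the additional zero roots
  -- contribute `0 ln 0 = 0`.
  have h := congrArg Polynomial.roots (Matrix.charpoly_mul_comm' A B)
  rw [Polynomial.roots_mul, Polynomial.roots_mul, Polynomial.roots_X_pow,
    Polynomial.roots_X_pow] at h
  · have h1 := congrArg (fun s => (Multiset.map (fun z : ℂ => Real.negMulLog z.re) s).sum) h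
    simpa [rootEntropy, Multiset.map_nsmul, Multiset.sum_nsmul] using h1
  · exact mul_ne_zero (pow_ne_zero _ Polynomial.X_ne_zero) (Matrix.charpoly_monic _).ne_zero
  · exact mul_ne_zero (pow_ne_zero _ Polynomial.X_ne_zero) (Matrix.charpoly_monic _).ne_zero

/-! ### Pure states before and after a local measurement -/

section Pure

variable {a b : Type*} [Fintype a] [Fintype b]

/-- The matrix of coefficients of a vector of a tensor product. -/
def coeffMatrix (ψ : EuclideanSpace ℂ (a × b)) : Matrix a b ℂ :=
  Matrix.of fun i k => ψ (i, k)

theorem reduceA_pure_mat (ψ : EuclideanSpace ℂ (a × b)) (hψ : ‖ψ‖ = 1) :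
    (DensityMatrix.pure ψ hψ).reduceA.mat = coeffMatrix ψ * (coeffMatrix ψ).conjTranspose := by
  ext i j
  simp [DensityMatrix.reduceA, DensityMatrix.pure, ketbra, Matrix.vecMulVec_apply, Matrix.mul_apply,
    coeffMatrix]

theorem reduceB_pure_mat (ψ : EuclideanSpace ℂ (a × b)) (hψ : ‖ψ‖ = 1) :
    (DensityMatrix.pure ψ hψ).reduceB.mat =
      ((coeffMatrix ψ).conjTranspose * coeffMatrix ψ).transpose := by
  ext i j
  simp [DensityMatrix.reduceB, DensityMatrix.pure, ketbra, Matrix.vecMulVec_apply, Matrix.mul_apply,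
    coeffMatrix, mul_comm]

theorem vonNeumann_reduceB_pure [DecidableEq a] [DecidableEq b] (ψ : EuclideanSpace ℂ (a × b)) (hψ : ‖ψ‖ = 1) :
    vonNeumann (DensityMatrix.pure ψ hψ).reduceB =
      vonNeumann (DensityMatrix.pure ψ hψ).reduceA := by
  rw [vonNeumann_eq_rootEntropy, vonNeumann_eq_rootEntropy, reduceA_pure_mat, reduceB_pure_mat,
    rootEntropy_transpose, rootEntropy_mul_comm]

/-- The matrix with the columns `x i`. -/
noncomputable def basisMatrix (x : OrthonormalBasis a ℂ (EuclideanSpace ℂ a)) : Matrix a a ℂ :=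
  Matrix.of fun k i => x i k

theorem basisMatrix_conjTranspose_mul_self [DecidableEq a] (x : OrthonormalBasis a ℂ (EuclideanSpace ℂ a)) :
    (basisMatrix x).conjTranspose * basisMatrix x = 1 := by
  ext i j
  have h := orthonormal_iff_ite.1 x.orthonormal i j
  rw [PiLp.inner_apply] at h
  simpa [Matrix.mul_apply, basisMatrix, Matrix.one_apply, mul_comm] using h

theorem basisMatrix_mul_conjTranspose_self [DecidableEq a] (x : OrthonormalBasis a ℂ (EuclideanSpace ℂ a)) :
    basisMatrix x * (basisMatrix x).conjTranspose = 1 :=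
  mul_eq_one_comm.1 (basisMatrix_conjTranspose_mul_self x)

/-- The unnormalized conditional states of `B` after the measurement, as rows. -/
noncomputable def condMatrix (ψ : EuclideanSpace ℂ (a × b)) (x : OrthonormalBasis a ℂ (EuclideanSpace ℂ a)) :
    Matrix a b ℂ :=
  (basisMatrix x).conjTranspose * coeffMatrix ψ

/-- The vectors `(|x i⟩⟨x i| ⊗ I) ψ`, as columns. -/
noncomputable def measuredMatrix (ψ : EuclideanSpace ℂ (a × b))
    (x : OrthonormalBasis a ℂ (EuclideanSpace ℂ a)) : Matrix (a × b) a ℂ :=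
  Matrix.of fun z i => basisMatrix x z.1 i * condMatrix ψ x i z.2

theorem localProj_mulVec [DecidableEq b] (ψ : EuclideanSpace ℂ (a × b))
    (x : OrthonormalBasis a ℂ (EuclideanSpace ℂ a)) (i : a) :
    (localProj (x i)).mulVec ψ.ofLp = (measuredMatrix ψ x).col i := by
  ext ⟨k, l⟩
  simp [Matrix.mulVec, dotProduct, localProj, ketbra, Matrix.vecMulVec_apply, Matrix.one_apply,
    Fintype.sum_prod_type, measuredMatrix, condMatrix, basisMatrix, coeffMatrix, Matrix.mul_apply,
    Finset.mul_sum, mul_assoc]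

theorem measureA_pure_mat [DecidableEq a] [DecidableEq b] (ψ : EuclideanSpace ℂ (a × b)) (hψ : ‖ψ‖ = 1)
    (x : OrthonormalBasis a ℂ (EuclideanSpace ℂ a)) :
    ((DensityMatrix.pure ψ hψ).measureA x).mat =
      measuredMatrix ψ x * (measuredMatrix ψ x).conjTranspose := by
  have h : ∀ i, localProj (x i) * ketbra ψ * localProj (x i) =
      Matrix.vecMulVec ((measuredMatrix ψ x).col i) (star ((measuredMatrix ψ x).col i)) :=
    fun i => by
      have h1 : Matrix.vecMul (star ψ.ofLp) (localProj (x i)) =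
          star ((localProj (x i)).mulVec ψ.ofLp) := by
        rw [Matrix.star_mulVec, (localProj_isHermitian (x i)).eq]
      rw [ketbra, Matrix.mul_vecMulVec, Matrix.vecMulVec_mul, h1, localProj_mulVec]
  simp only [DensityMatrix.measureA, DensityMatrix.pure, h]
  ext z w
  simp [Matrix.sum_apply, Matrix.vecMulVec_apply, Matrix.mul_apply]

theorem condMatrix_mul_conjTranspose_apply_re {N : ℕ} (ψ : EuclideanSpace ℂ (Fin N × b))
    (hψ : ‖ψ‖ = 1) (x : OrthonormalBasis (Fin N) ℂ (EuclideanSpace ℂ (Fin N))) (i : Fin N) :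
    ((condMatrix ψ x * (condMatrix ψ x).conjTranspose) i i).re =
      (DensityMatrix.pure ψ hψ).reduceA.outcomeProb x i := by
  rw [DensityMatrix.outcomeProb, reduceA_pure_mat, condMatrix, Matrix.conjTranspose_mul,
    Matrix.conjTranspose_conjTranspose, Matrix.mul_assoc,
    ← Matrix.mul_assoc (coeffMatrix ψ)]
  rfl

/-- The columns are product vectors `x_i ⊗ c_i`, hence orthogonal, with squared lengths equal to the
outcome probabilities. -/
theorem measuredMatrix_conjTranspose_mul_self [DecidableEq a] (ψ : EuclideanSpace ℂ (a × b))
    (x : OrthonormalBasis a ℂ (EuclideanSpace ℂ a)) :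
    (measuredMatrix ψ x).conjTranspose * measuredMatrix ψ x =
      Matrix.diagonal fun i => (condMatrix ψ x * (condMatrix ψ x).conjTranspose) i i := by
  ext i j
  have h : ((measuredMatrix ψ x).conjTranspose * measuredMatrix ψ x) i j =
      ((basisMatrix x).conjTranspose * basisMatrix x) i j *
        (condMatrix ψ x * (condMatrix ψ x).conjTranspose) j i := by
    simp only [Matrix.mul_apply, measuredMatrix, Matrix.conjTranspose_apply, Matrix.of_apply,
      Fintype.sum_prod_type, Finset.sum_mul_sum, star_mul']
    exact Finset.sum_congr rfl fun _ _ => Finset.sum_congr rfl fun _ _ => by ring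
  rw [h, basisMatrix_conjTranspose_mul_self, Matrix.one_apply, Matrix.diagonal_apply]
  split_ifs with hij
  · rw [hij, one_mul]
  · rw [zero_mul]

/-- The measurement of `A` in a pure state: the entropy of the resulting state. -/
theorem vonNeumann_measureA_pure [DecidableEq b] {N : ℕ} (ψ : EuclideanSpace ℂ (Fin N × b)) (hψ : ‖ψ‖ = 1)
    (x : OrthonormalBasis (Fin N) ℂ (EuclideanSpace ℂ (Fin N))) :
    vonNeumann ((DensityMatrix.pure ψ hψ).measureA x) =
      shannon ((DensityMatrix.pure ψ hψ).reduceA.outcomeProb x) := by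
  rw [vonNeumann_eq_rootEntropy, measureA_pure_mat, rootEntropy_mul_comm,
    measuredMatrix_conjTranspose_mul_self, rootEntropy_diagonal]
  simp only [condMatrix_mul_conjTranspose_apply_re ψ hψ]

/-- A measurement of `A` does not change the state of `B`. -/
theorem reduceB_measureA_pure_mat [DecidableEq a] [DecidableEq b] (ψ : EuclideanSpace ℂ (a × b)) (hψ : ‖ψ‖ = 1)
    (x : OrthonormalBasis a ℂ (EuclideanSpace ℂ a)) :
    ((DensityMatrix.pure ψ hψ).measureA x).reduceB.mat =
      (DensityMatrix.pure ψ hψ).reduceB.mat := by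
  have h1 : (condMatrix ψ x).conjTranspose * condMatrix ψ x =
      (coeffMatrix ψ).conjTranspose * coeffMatrix ψ := by
    rw [condMatrix, Matrix.conjTranspose_mul, Matrix.conjTranspose_conjTranspose,
      Matrix.mul_assoc, ← Matrix.mul_assoc (basisMatrix x), basisMatrix_mul_conjTranspose_self,
      Matrix.one_mul]
  rw [reduceB_pure_mat, ← h1]
  ext k l
  have h2 : ((DensityMatrix.pure ψ hψ).measureA x).reduceB.mat k l =
      ∑ i, ((basisMatrix x).conjTranspose * basisMatrix x) i i *
        (star (condMatrix ψ x i l) * condMatrix ψ x i k) := by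
    change ∑ c, ((DensityMatrix.pure ψ hψ).measureA x).mat (c, k) (c, l) = _
    rw [measureA_pure_mat]
    simp only [Matrix.mul_apply, measuredMatrix, Matrix.conjTranspose_apply, Matrix.of_apply,
      star_mul', Finset.sum_mul]
    rw [Finset.sum_comm]
    exact Finset.sum_congr rfl fun _ _ => Finset.sum_congr rfl fun _ _ => by ring
  rw [h2, basisMatrix_conjTranspose_mul_self]
  simp [Matrix.mul_apply]

theorem vonNeumann_congr {n : Type*} [Fintype n] [DecidableEq n] {ρ σ : DensityMatrix n}
    (h : ρ.mat = σ.mat) : vonNeumann ρ = vonNeumann σ := by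
  rw [vonNeumann_eq_rootEntropy, vonNeumann_eq_rootEntropy, h]

end Pure

/-! ### The sorted spectrum and the outcome probabilities -/

section Spectrum

variable {N : ℕ}

theorem shannon_sortedSpectrum (ρ : DensityMatrix (Fin N)) :
    shannon ρ.sortedSpectrum = vonNeumann ρ := by
  rw [vonNeumann_eq_rootEntropy, rootEntropy,
    ρ.posSemidef.isHermitian.roots_charpoly_eq_eigenvalues₀, Multiset.map_map]
  exact (finCongr (Fintype.card_fin N).symm).sum_comp
    fun i => Real.negMulLog (ρ.posSemidef.isHermitian.eigenvalues₀ i)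

theorem sortedSpectrum_antitone (ρ : DensityMatrix (Fin N)) : Antitone ρ.sortedSpectrum :=
  fun _ _ hij => ρ.posSemidef.isHermitian.eigenvalues₀_antitone hij

/-- An orthonormal eigenbasis in the order of the sorted spectrum. -/
theorem exists_sorted_eigenbasis (ρ : DensityMatrix (Fin N)) :
    ∃ e : OrthonormalBasis (Fin N) ℂ (EuclideanSpace ℂ (Fin N)), ∀ i,
      Matrix.toEuclideanLin ρ.mat (e i) = (ρ.sortedSpectrum i : ℂ) • e i := by
  have hs := Matrix.isSymmetric_toEuclideanLin_iff.mpr ρ.posSemidef.isHermitian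
  refine ⟨(hs.eigenvectorBasis finrank_euclideanSpace).reindex
    (finCongr (Fintype.card_fin N)), fun i => ?_⟩
  rw [OrthonormalBasis.reindex_apply]
  exact hs.apply_eigenvectorBasis finrank_euclideanSpace _

theorem outcomeProb_eq_inner (ρ : DensityMatrix (Fin N))
    (x : OrthonormalBasis (Fin N) ℂ (EuclideanSpace ℂ (Fin N))) (i : Fin N) :
    ρ.outcomeProb x i = (inner ℂ (x i) (Matrix.toEuclideanLin ρ.mat (x i))).re := by
  rw [DensityMatrix.outcomeProb, EuclideanSpace.inner_eq_star_dotProduct, dotProduct_comm]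
  rfl

theorem outcomeProb_eq_sum (ρ : DensityMatrix (Fin N))
    (x e : OrthonormalBasis (Fin N) ℂ (EuclideanSpace ℂ (Fin N)))
    (he : ∀ i, Matrix.toEuclideanLin ρ.mat (e i) = (ρ.sortedSpectrum i : ℂ) • e i) (i : Fin N) :
    ρ.outcomeProb x i = ∑ l, ρ.sortedSpectrum l * ‖inner ℂ (x i) (e l)‖ ^ 2 := by
  have hs := Matrix.isSymmetric_toEuclideanLin_iff.mpr ρ.posSemidef.isHermitian
  rw [outcomeProb_eq_inner, ← e.sum_inner_mul_inner, Complex.re_sum]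
  refine Finset.sum_congr rfl fun l _ => ?_
  rw [← hs, he, inner_smul_left, Complex.conj_ofReal, mul_left_comm, Complex.re_ofReal_mul]
  have h := inner_mul_symm_re_eq_norm (𝕜 := ℂ) (x i) (e l)
  rw [norm_mul, norm_inner_symm (e l), ← sq] at h
  exact congrArg _ h

theorem outcomeProb_nonneg (ρ : DensityMatrix (Fin N))
    (x : OrthonormalBasis (Fin N) ℂ (EuclideanSpace ℂ (Fin N))) (i : Fin N) :
    0 ≤ ρ.outcomeProb x i :=
  ρ.posSemidef.re_dotProduct_nonneg _

/-- The eigenvalues are the outcome probabilities of a measurement in the eigenbasis. -/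
theorem sortedSpectrum_nonneg (ρ : DensityMatrix (Fin N)) (i : Fin N) :
    0 ≤ ρ.sortedSpectrum i := by
  obtain ⟨e, he⟩ := exists_sorted_eigenbasis ρ
  have h := outcomeProb_nonneg ρ e i
  rw [outcomeProb_eq_inner, he, inner_smul_right, inner_self_eq_norm_sq_to_K, e.norm_eq_one] at h
  simpa using h

theorem sum_sortedSpectrum (ρ : DensityMatrix (Fin N)) : ∑ i, ρ.sortedSpectrum i = 1 := by
  have h := ρ.posSemidef.isHermitian.trace_eq_sum_eigenvalues
  rw [ρ.trace_eq_one] at h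
  have h1 : ∑ i, ρ.sortedSpectrum i = ∑ i, ρ.posSemidef.isHermitian.eigenvalues i := by
    rw [show (∑ i, ρ.sortedSpectrum i) = ∑ i, ρ.posSemidef.isHermitian.eigenvalues₀ i from
      (finCongr (Fintype.card_fin N).symm).sum_comp ρ.posSemidef.isHermitian.eigenvalues₀]
    exact ((Fintype.equivOfCardEq (Fintype.card_fin _)).symm.sum_comp
      ρ.posSemidef.isHermitian.eigenvalues₀).symm
  rw [h1]
  refine Complex.ofReal_injective ?_
  rw [Complex.ofReal_sum, Complex.ofReal_one]
  exact h.symm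

theorem sum_outcomeProb (ρ : DensityMatrix (Fin N))
    (x : OrthonormalBasis (Fin N) ℂ (EuclideanSpace ℂ (Fin N))) :
    ∑ i, ρ.outcomeProb x i = 1 := by
  obtain ⟨e, he⟩ := exists_sorted_eigenbasis ρ
  simp_rw [outcomeProb_eq_sum ρ x e he]
  rw [Finset.sum_comm, ← sum_sortedSpectrum ρ]
  refine Finset.sum_congr rfl fun l _ => ?_
  rw [← Finset.mul_sum, x.sum_sq_norm_inner_right, e.norm_eq_one, one_pow, mul_one]

end Spectrum

/-! ### Assembly of the uncertainty relation -/

theorem bigS_zero {N : ℕ} (lam : Fin N → ℝ) (U : Matrix (Fin N) (Fin N) ℂ) :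
    bigS lam U 0 = 0 := by
  simp [bigS]

theorem pos_of_norm_eq_one {N M : ℕ} {ψ : EuclideanSpace ℂ (Fin N × Fin M)} (hψ : ‖ψ‖ = 1) :
    0 < N := by
  rcases Nat.eq_zero_or_pos N with rfl | h
  · rw [EuclideanSpace.norm_eq] at hψ
    simp at hψ
  · exact h

theorem jointP_nonneg {N : ℕ} {H : Type*} [NormedAddCommGroup H] [InnerProductSpace ℂ H]
    (x y : OrthonormalBasis (Fin N) ℂ H) {lam : Fin N → ℝ} (h0 : ∀ i, 0 ≤ lam i)
    (k : Fin (2 * N)) (j : Fin N) : 0 ≤ jointP lam (overlap x y) k j := by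
  rw [jointP_apply, lamMatrix_apply]
  have := pad_nonneg h0 (lamIndex k j + 1)
  have := wVec_nonneg x y j
  positivity

/-- The entropic uncertainty relation for a state `ρ` and two von Neumann measurements. -/
theorem shannon_wLam_le {N : ℕ} (hN : 0 < N) (ρ : DensityMatrix (Fin N))
    (x y : OrthonormalBasis (Fin N) ℂ (EuclideanSpace ℂ (Fin N))) :
    shannon (wLam ρ.sortedSpectrum (overlap x y)) ≤
      shannon (ρ.outcomeProb x) + shannon (ρ.outcomeProb y) := by
  set lam := ρ.sortedSpectrum with hlam
  set U := overlap x y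
  have h0 := sortedSpectrum_nonneg ρ
  obtain ⟨e, he⟩ := exists_sorted_eigenbasis ρ
  have hL : wLam lam U = (lamMatrix lam).mulVec (wVec U) :=
    wLam_eq_mulVec lam (sCoeff_zero _) (fun k hk hk2 => sCoeff_eq_one x y hk hk2) hN
  let w : ℕ → ℝ := fun k => if h : k < 2 * N then wLam lam U ⟨k, h⟩ else 0
  have hw0 : ∀ k, 0 ≤ w k := fun k => by
    simp only [w]
    split_ifs with h
    · have h1 := rowMarginal_jointP hL ⟨k, h⟩
      -- Nonnegativity of `W^{(λ)}` is not visible from the differences of the `S_k`; it comes from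
      -- the row sums of `P`.
      have h2 : 0 ≤ rowMarginal (jointP lam U) ⟨k, h⟩ :=
        Finset.sum_nonneg fun j _ => jointP_nonneg x y h0 _ j
      linarith
    · exact le_rfl
  have hwsum : ∀ m ≤ 2 * N, ∑ k ∈ Finset.range m, w k = bigS lam U m := fun m hm => by
    rw [Finset.sum_congr rfl fun k hk => show w k = bigS lam U (k + 1) - bigS lam U k by
        simp only [w, dif_pos ((Finset.mem_range.1 hk).trans_le hm), wLam],
      Finset.sum_range_sub, bigS_zero, sub_zero]
  let a : Fin N ⊕ Fin N → ℝ := Sum.elim (ρ.outcomeProb x) (ρ.outcomeProb y)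
  have ha : ∀ i, a i = ∑ l, lam l * ‖inner ℂ (Sum.elim x y i) (e l)‖ ^ 2 := by
    rintro (i | i)
    · exact outcomeProb_eq_sum ρ x e he i
    · exact outcomeProb_eq_sum ρ y e he i
  have hcard : Fintype.card (Fin N ⊕ Fin N) = 2 * N := by simp; omega
  have hmaj : ∀ I : Finset (Fin N ⊕ Fin N), ∑ i ∈ I, a i ≤ ∑ k ∈ Finset.range I.card, w k :=
    fun I => by
      rw [hwsum _ (hcard ▸ I.card_le_univ)]
      simp_rw [ha]
      exact sum_outcome_le_bigS x y e (sortedSpectrum_antitone ρ) h0 I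
  have htot : ∑ i, a i = ∑ k ∈ Finset.range (2 * N), w k := by
    rw [Fintype.sum_sum_type, Finset.sum_range]
    simp only [a, Sum.elim_inl, Sum.elim_inr, sum_outcomeProb, w, Fin.is_lt, dif_pos, Fin.eta, hL,
      Matrix.mulVec, dotProduct]
    have h1 : ∀ j, ∑ k, lamMatrix lam k j = 2 := fun j => by
      have h := sum_lamMatrix id lam j
      simpa only [id, hlam, sum_sortedSpectrum, mul_one] using h
    rw [Finset.sum_comm]
    simp_rw [← Finset.sum_mul, h1, ← Finset.mul_sum]
    rw [sum_wVec_eq_one (sCoeff_zero _) (fun k hk hk2 => sCoeff_eq_one x y hk hk2) hN]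
    norm_num
  have h := shannon_le_of_majorized hcard (a := a) (w := w) (by
    rintro (i | i)
    · exact outcomeProb_nonneg ρ x i
    · exact outcomeProb_nonneg ρ y i) hw0 hmaj htot
  have h1 : shannon a = shannon (ρ.outcomeProb x) + shannon (ρ.outcomeProb y) := by
    rw [shannon, Fintype.sum_sum_type]; rfl
  rw [← h1]
  refine le_of_eq_of_le ?_ h
  rw [shannon, Finset.sum_range]
  exact Finset.sum_congr rfl fun k _ => by simp only [w, dif_pos k.2]

end EntropicUncertainty

open EntropicUncertainty in
theorem mainTheorem3 (N M : ℕ)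
    (ψ : EuclideanSpace ℂ (Fin N × Fin M)) (hψ : ‖ψ‖ = 1)
    (x y : OrthonormalBasis (Fin N) ℂ (EuclideanSpace ℂ (Fin N)))
    (ρ : DensityMatrix (Fin N × Fin M)) (hρ : ρ = DensityMatrix.pure ψ hψ)
    (p q lam : Fin N → ℝ)
    (hp : p = ρ.reduceA.outcomeProb x) (hq : q = ρ.reduceA.outcomeProb y)
    (hlam : lam = ρ.reduceA.sortedSpectrum)
    (U : Matrix (Fin N) (Fin N) ℂ) (hU : U = Matrix.of fun i j => inner ℂ (x i) (y j)) :
    condEntropy (ρ.measureA x) + condEntropy (ρ.measureA y) =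
        vonNeumann (ρ.measureA x) + vonNeumann (ρ.measureA y) - 2 * vonNeumann ρ.reduceB ∧
    condEntropy (ρ.measureA x) + condEntropy (ρ.measureA y) =
        shannon p + shannon q - 2 * shannon lam ∧
    shannon p + shannon q - 2 * shannon lam ≥ shannon (wLam lam U) - 2 * shannon lam ∧
    shannon (wLam lam U) - 2 * shannon lam = 2 * mutualInfo (jointP lam U) ∧
    2 * mutualInfo (jointP lam U) ≥ 0 ∧
    (∀ k j, 0 ≤ jointP lam U k j) ∧ ∑ k, ∑ j, jointP lam U k j = 1 ∧
    (∀ k, rowMarginal (jointP lam U) k = 1 / 2 * wLam lam U k) ∧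
    (∀ j, colMarginal (jointP lam U) j = wVec U j) ∧
    wLam lam U = (lamMatrix lam).mulVec (wVec U) := by
  -- The space for `N = 0` contains no unit vector.
  have hN := pos_of_norm_eq_one hψ
  have hU' : U = overlap x y := hU
  subst hU' hρ
  have h0 : ∀ i, 0 ≤ lam i := fun i => by rw [hlam]; exact sortedSpectrum_nonneg _ i
  have h1 : ∑ i, lam i = 1 := by rw [hlam]; exact sum_sortedSpectrum _
  have hs := fun k (hk : N ≤ k) (hk2 : k < 2 * N) => sCoeff_eq_one x y hk hk2
  have hL : wLam lam (overlap x y) = (lamMatrix lam).mulVec (wVec (overlap x y)) :=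
    wLam_eq_mulVec lam (sCoeff_zero _) hs hN
  have hW := sum_wVec_eq_one (sCoeff_zero (overlap x y)) hs hN
  have hI := two_mul_mutualInfo_jointP h1 hL hW
  have hP := jointP_nonneg x y h0
  have hP1 : ∑ k, ∑ j, jointP lam (overlap x y) k j = 1 := by
    rw [← hW]
    refine (Finset.sum_comm (f := fun k j => jointP lam (overlap x y) k j)).trans ?_
    exact Finset.sum_congr rfl fun j _ => colMarginal_jointP h1 _ j
  have hcond : condEntropy ((DensityMatrix.pure ψ hψ).measureA x) +
      condEntropy ((DensityMatrix.pure ψ hψ).measureA y) =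
      vonNeumann ((DensityMatrix.pure ψ hψ).measureA x) +
        vonNeumann ((DensityMatrix.pure ψ hψ).measureA y) -
        2 * vonNeumann (DensityMatrix.pure ψ hψ).reduceB := by
    rw [condEntropy, condEntropy, vonNeumann_congr (reduceB_measureA_pure_mat ψ hψ x),
      vonNeumann_congr (reduceB_measureA_pure_mat ψ hψ y)]
    ring
  refine ⟨hcond, ?_, ?_, hI.symm, ?_, hP, hP1, rowMarginal_jointP hL, colMarginal_jointP h1 _, hL⟩
  · rw [hcond, vonNeumann_measureA_pure, vonNeumann_measureA_pure, vonNeumann_reduceB_pure, hp, hq,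
      hlam, shannon_sortedSpectrum]
  · have h := shannon_wLam_le hN (DensityMatrix.pure ψ hψ).reduceA x y
    rw [← hp, ← hq, ← hlam] at h
    linarith
  · exact mul_nonneg zero_le_two (mutualInfo_nonneg hP hP1)
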